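/- Let $q$ be a power of a prime, $A=\mathbb{F}_{q^2}[x,y]$, $H=x^{q+1}-y^q-y\in A$, let $\mathcal H$ be the affine plane curve $H=0$, and let $E=\{P_1,\dots,P_n\}$ be the set of its points with coordinates in $\mathbb{F}_{q^2}$. Put $w(x^ry^s)=rq+s(q+1)$. For an integer $m\ge 0$ let $V_m$ be the span of the monomials of $w$-degree at most $m$, and let the Hermitian code $C_m\subseteq \mathbb{F}_{q^2}^{\,n}$ be the dual of the code $\{(f(P_1),\dots,f(P_n)) : f\in V_m\}$. The support of a codeword is identified with the subset $D\subseteq E$ of the points at which its entry is nonzero; a minimum-weight codeword is a nonzero codeword of least weight. For $D\subseteq E$ let $I_D\subseteq A$ be the ideal of all polynomials vanishing on $D$; we say that $D$ is the complete intersection of the curves $F=0$ and $G=0$ if $I_D=\langle F,G\rangle$. Leading monomials $\mathrm{LM}$ are taken with respect to the degree reverse lexicographic order with $y>x$. Let $\Lambda$ be the additive semigroup (containing $0$) generated by $q$ and $q+1$; let $\mathcal B=\{x^ry^s : 0\le r\le q,\ 0\le s\le q^2-q-1\}\cup\{y^s : q^2-q\le s\le q^2-1\}$ and $\Lambda_{\mathcal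 B}=w(\mathcal B)$; put $\delta(m)=m-(q-2)(q+1)$. Let $\widetilde m$ be the least integer $m'\ge m$ such that $m'+1\in\Lambda_{\mathcal B}$ and $\delta(m')\in\Lambda$, and put $\widetilde\delta_m=\delta(\widetilde m)$. **Theorem.** Let $q^2-q-1\le m\le 2q^2-2q-3$ and $m<\widetilde m$. Then there is an integer $\mu$ with $1\le\mu\le q-1$ and $\widetilde\delta_m=\mu q=w(x^\mu)$, and the following hold. A set $D\subseteq E$ is the support of a minimum-weight codeword of $C_m$ if and only if one of the following holds: (i) $D$ is the complete intersection of $\mathcal H$ and a curve $F=0$ with $F\in A$, $\mathrm{LM}(F)=x^\mu$; (ii) $m=(\mu+q-3)(q+1)+1$, and $D$ is the complete intersection of two curves $F_1=0$ and $F_2=0$ with $F_1,F_2\in A$, $\mathrm{LM}(F_1)=x^q$ and $\mathrm{LM}(F_2)=y^\mu$. If $m=(\mu+q-3)(q+1)+1$, then sets $D\subseteq E$ as in (ii) exist. Moreover, no curve defined by a polynomial in $A$ with leading monomial $x^q$ or $y^\mu$ is equal to $\mathcal H$ (as a set of points over the algebraic closure of $\mathbb{F}_{q^2}$). -/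

import Mathlib

namespace HermitianCode

/-! Throughout, polynomials in `x, y` are `MvPolynomial (Fin 2) k`, with `x = X 0` and `y = X 1`;
an exponent vector `e : Fin 2 →₀ ℕ` stands for the monomial `x ^ e 0 * y ^ e 1`. -/

/-- The exponent vector of the monomial `x ^ r * y ^ s`. -/
noncomputable def expXY (r s : ℕ) : Fin 2 →₀ ℕ :=
  Finsupp.single 0 r + Finsupp.single 1 s

/-- The strict degree reverse lexicographic term order on monomials in `x, y`, with `x ≺ y`:
compare total degrees first; for equal total degrees the monomial with the larger exponent of the
smallest variable `x` is the smaller one. -/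
def DegRevLexLT (a b : Fin 2 →₀ ℕ) : Prop :=
  a 0 + a 1 < b 0 + b 1 ∨ (a 0 + a 1 = b 0 + b 1 ∧ b 0 < a 0)

/-- `e` is the leading monomial of `f` for the degree reverse lexicographic order. -/
def HasLM {k : Type*} [CommSemiring k] (f : MvPolynomial (Fin 2) k) (e : Fin 2 →₀ ℕ) : Prop :=
  e ∈ f.support ∧ ∀ d ∈ f.support, d ≠ e → DegRevLexLT d e

/-- The weighted degree `w(x ^ r * y ^ s) = r * q + s * (q + 1)`. -/
def wdeg (q : ℕ) (e : Fin 2 →₀ ℕ) : ℕ := e 0 * q + e 1 * (q + 1)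

/-- The Hermitian polynomial `H = x ^ (q + 1) - y ^ q - y`. -/
noncomputable def hermitianPoly (k : Type*) [CommRing k] (q : ℕ) : MvPolynomial (Fin 2) k :=
  MvPolynomial.X 0 ^ (q + 1) - MvPolynomial.X 1 ^ q - MvPolynomial.X 1

/-- The set `E` of the points of the Hermitian curve with coordinates in `k`. -/
def E (k : Type*) [CommRing k] (q : ℕ) : Set (Fin 2 → k) :=
  {P | MvPolynomial.eval P (hermitianPoly k q) = 0}

noncomputable instance (k : Type*) [CommRing k] [Finite k] (q : ℕ) : Fintype (E k q) :=
  Fintype.ofFinite _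

/-- The evaluation map `f ↦ (f(P))_{P ∈ E}`. -/
noncomputable def evalE (k : Type*) [CommRing k] (q : ℕ) :
    MvPolynomial (Fin 2) k →ₗ[k] (E k q → k) :=
  LinearMap.pi fun P => (MvPolynomial.aeval (R := k) (P : Fin 2 → k)).toLinearMap

/-- The span of the monomials of weighted degree less than `m + 1`. -/
noncomputable def V (k : Type*) [CommRing k] (q m : ℕ) : Submodule k (MvPolynomial (Fin 2) k) :=
  Submodule.span k {f | ∃ e : Fin 2 →₀ ℕ, wdeg q e < m + 1 ∧ f = MvPolynomial.monomial e 1}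

/-- The dual of a linear code with respect to the standard bilinear form. -/
def dualCode {k ι : Type*} [CommRing k] [Fintype ι] (C : Submodule k (ι → k)) :
    Submodule k (ι → k) where
  carrier := {c | ∀ v ∈ C, v ⬝ᵥ c = 0}
  add_mem' ha hb v hv := by rw [dotProduct_add, ha v hv, hb v hv, add_zero]
  zero_mem' v _ := dotProduct_zero v
  smul_mem' a c hc v hv := by rw [dotProduct_smul, hc v hv, smul_zero]

/-- The Hermitian code `C_m`: the dual of the code obtained by evaluating `V_m` at `E`. -/
noncomputable def code (k : Type*) [CommRing k] [Finite k] (q m : ℕ) : Submodule k (E k q → k) :=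
  dualCode ((V k q m).map (evalE k q))

open Classical in
/-- `c` is a minimum-weight codeword of `C`: a nonzero codeword whose weight is minimal among the
nonzero codewords. -/
def IsMinWeightCodeword {k ι : Type*} [CommRing k] [Fintype ι] (C : Submodule k (ι → k))
    (c : ι → k) : Prop :=
  c ∈ C ∧ c ≠ 0 ∧ ∀ c' ∈ C, c' ≠ 0 → hammingNorm c ≤ hammingNorm c'

/-- The set `M_m` of the divisors (sets of points of `E`) that are the support of some
minimum-weight codeword of `C_m`. -/
def minSupports (k : Type*) [CommRing k] [Finite k] (q m : ℕ) : Set (Finset (E k q)) :=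
  {D | ∃ c, IsMinWeightCodeword (code k q m) c ∧ Function.support c = (D : Set (E k q))}

/-- The ideal `I_D` of all polynomials over `k` that vanish at every point of `D`. -/
noncomputable def idealOf {k : Type*} [Field k] {q : ℕ} (D : Finset (E k q)) :
    Ideal (MvPolynomial (Fin 2) k) :=
  MvPolynomial.vanishingIdeal k ((fun P : E k q => (P : Fin 2 → k)) '' (D : Set (E k q)))

/-- `D` is the (scheme-theoretic) complete intersection of the curves `f = 0` and `g = 0`. -/
def IsCompleteIntersection {k : Type*} [Field k] {q : ℕ} (D : Finset (E k q))
    (f g : MvPolynomial (Fin 2) k) : Prop :=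
  idealOf D = Ideal.span {f, g}

/-- The affine plane curve `f = 0`, as a set of points over the algebraic closure of `k`. -/
def curve {k : Type*} [Field k] (f : MvPolynomial (Fin 2) k) :
    Set (Fin 2 → AlgebraicClosure k) :=
  MvPolynomial.zeroLocus (AlgebraicClosure k) (Ideal.span {f})

/-- The semigroup `Λ` generated by `q` and `q + 1`. -/
def Lam (q : ℕ) : AddSubmonoid ℤ := AddSubmonoid.closure {(q : ℤ), (q : ℤ) + 1}

/-- The monomials outside the initial ideal `⟨x ^ (q + 1), x * y ^ (q ^ 2 - q), y ^ (q ^ 2)⟩` of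
the ideal of `E`. -/
def B (q : ℕ) : Set (Fin 2 →₀ ℕ) :=
  {e | e 0 ≤ q ∧ e 1 < q ^ 2 - q} ∪ {e | e 0 = 0 ∧ q ^ 2 - q ≤ e 1 ∧ e 1 < q ^ 2}

/-- The set `Λ_B` of the weighted degrees of the monomials in `B`. -/
def LamB (q : ℕ) : Set ℕ := wdeg q '' B q

/-- `δ(m) = m - (q - 2) * (q + 1)`. -/
def delta (q m : ℕ) : ℤ := (m : ℤ) - ((q : ℤ) - 2) * ((q : ℤ) + 1)

/-- The integers `m' ≥ m` with `m' + 1 ∈ Λ_B` and `δ(m') ∈ Λ`. -/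
def admissible (q m : ℕ) : Set ℕ := {m' | m ≤ m' ∧ m' + 1 ∈ LamB q ∧ delta q m' ∈ Lam q}

/-- `m̃`, the least integer `m' ≥ m` with `m' + 1 ∈ Λ_B` and `δ(m') ∈ Λ`. -/
noncomputable def mTilde (q m : ℕ) : ℕ := sInf (admissible q m)

/-- `δ̃_m = δ(m̃)`. -/
noncomputable def deltaTilde (q m : ℕ) : ℤ := delta q (mTilde q m)

/-- In the range used below, the set that defines `m̃` is not empty. -/
theorem mTilde_mem (q m : ℕ) (hq : 2 ≤ q) (hm : (m : ℤ) ≤ 2 * (q : ℤ) ^ 2 - 2 * q - 3) :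
    mTilde q m ∈ admissible q m := by
  apply Nat.sInf_mem
  obtain ⟨a, rfl⟩ := Nat.exists_eq_add_of_le hq
  refine ⟨2 * a ^ 2 + 6 * a + 2, ?_, ⟨expXY a (a + 1), Or.inl ⟨?_, ?_⟩, ?_⟩, ?_⟩
  · zify; push_cast at hm; nlinarith
  · simp [expXY]
  · have : a + 1 + (2 + a) < (2 + a) ^ 2 := by nlinarith
    simp [expXY]; omega
  · simp [expXY, wdeg]; ring
  · have h : (((2 + a : ℕ) : ℤ)) ∈ Lam (2 + a) :=
      AddSubmonoid.subset_closure (Set.mem_insert _ _)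
    have h2 := AddSubmonoid.nsmul_mem _ h (a + 1)
    convert h2 using 1
    simp [delta]; ring

/-- Divisors of type (i): complete intersections of the Hermitian curve and a curve with leading
monomial `x ^ μ`. -/
def TypeI {k : Type*} [Field k] {q : ℕ} (μ : ℕ) (D : Finset (E k q)) : Prop :=
  ∃ f : MvPolynomial (Fin 2) k, HasLM f (expXY μ 0) ∧
    IsCompleteIntersection D (hermitianPoly k q) f

/-- Divisors of type (ii): complete intersections of two curves with leading monomials `x ^ q`
and `y ^ μ`. -/
def TypeII {k : Type*} [Field k] {q : ℕ} (μ : ℕ) (D : Finset (E k q)) : Prop :=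
  ∃ f g : MvPolynomial (Fin 2) k, HasLM f (expXY q 0) ∧ HasLM g (expXY 0 μ) ∧
    IsCompleteIntersection D f g

end HermitianCode

/-! The proof combines the order (Feng–Rao) bound with division by the weight `w`. A word `c`
defines the functional `f ↦ ∑ f(P) c(P)`. For a nonzero `c` in `C_m`, let `n > m` be the least
weight of a monomial on which it does not vanish. If a polynomial vanishing on the support had
`w`-leading monomial `u` with `n - w(u)` in `Λ`, multiplying it up to weight `n` would contradict
the minimality of `n` (`IsOrder.not_hasWLead`). So such monomials are independent on the support,
and counting them bounds the weight of `c` from below (`IsOrder.card_le`).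

Write `δ(m) = i * q + j` with `j < q`. The condition `m < m̃` forces `i < j`, and `μ = i + 1`. By
`le_orderBound` the bound is at least `μ * q`, with equality only when `n` is the weight of `x ^ i *
y ^ (q - 1)` or of `x ^ (q - 1) * y ^ i`; the second needs `m` to take the special value. At
equality the monomials dividing this one form a basis of the functions on `D`. Reducing the pure
powers just outside that box gives two elements of `I_D` leading with pure powers, and a dimension
count shows that they generate it.

Conversely, let `I_D = ⟨F, G⟩` with pure-power leads. Division does not raise `w`, so if `m` is
below the weight of the corner of the box, then `V_m` evaluates on `D` into a proper subspace of `k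
^ D`. This gives a nonzero codeword supported in `D` (`exists_codeword`), and the lower bound makes
its support all of `D`.

The remaining points are that degree reverse lexicographic and `w`-leading monomials agree for the
pure powers used, and that `E` contains a `(q + 1) × q` grid. Subgrids give type (ii), and the whole
grid separates low-degree curves from the Hermitian one. -/

namespace HermitianCode

open MvPolynomial

/-! ### Leading monomials for the weighted degree -/

section WeightedLead

variable {k : Type*} [Field k] {q : ℕ}

@[simp] theorem expXY_apply_zero (r s : ℕ) : expXY r s 0 = r := by simp [expXY]

@[simp] theorem expXY_apply_one (r s : ℕ) : expXY r s 1 = s := by simp [expXY]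

theorem exp_ext {d e : Fin 2 →₀ ℕ} (h0 : d 0 = e 0) (h1 : d 1 = e 1) : d = e := by
  ext i
  fin_cases i <;> assumption

theorem exp_le {d e : Fin 2 →₀ ℕ} (h0 : d 0 ≤ e 0) (h1 : d 1 ≤ e 1) : d ≤ e := by
  intro i
  fin_cases i <;> assumption

theorem wdeg_add (q : ℕ) (d e : Fin 2 →₀ ℕ) : wdeg q (d + e) = wdeg q d + wdeg q e := by
  simp [wdeg]
  ring

@[simp] theorem wdeg_expXY (q r s : ℕ) : wdeg q (expXY r s) = r * q + s * (q + 1) := by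
  simp [wdeg]

/-- Since `q` and `q + 1` are coprime, equal weights force the `x`-exponents to differ by a multiple
of `q + 1`. The bound is sharp: `x ^ (q + 1)` and `y ^ q` have the same weight, so `H` itself has no
`w`-leading monomial. -/
theorem eq_of_wdeg_eq {d e : Fin 2 →₀ ℕ} (hd : d 0 ≤ q) (he : e 0 ≤ q)
    (h : wdeg q d = wdeg q e) : d = e := by
  wlog hle : e 1 ≤ d 1 generalizing d e
  · exact (this he hd h.symm (by omega)).symm
  obtain ⟨t, ht⟩ := Nat.exists_eq_add_of_le hle
  unfold wdeg at h
  rw [ht] at h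
  have ht0 : t = 0 := by
    by_contra h0
    have h0' := Nat.pos_of_ne_zero h0
    have h1 : d 0 + t + 1 ≤ e 0 := by
      by_contra h2
      have : e 0 * q ≤ (d 0 + t) * q := Nat.mul_le_mul_right q (by omega)
      nlinarith
    have h2 : (d 0 + t + 1) * q ≤ e 0 * q := Nat.mul_le_mul_right q h1
    nlinarith
  subst ht0
  refine exp_ext ?_ (by omega)
  rcases Nat.eq_zero_or_pos q with rfl | hq
  · omega
  · exact Nat.eq_of_mul_eq_mul_right hq (by linarith)

/-- `u` is the unique monomial of maximal weighted degree of `f`. -/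
def HasWLead (q : ℕ) (f : MvPolynomial (Fin 2) k) (u : Fin 2 →₀ ℕ) : Prop :=
  coeff u f ≠ 0 ∧ ∀ d ∈ f.support, d ≠ u → wdeg q d < wdeg q u

theorem HasWLead.wdeg_le {f : MvPolynomial (Fin 2) k} {u d : Fin 2 →₀ ℕ} (h : HasWLead q f u)
    (hd : d ∈ f.support) : wdeg q d ≤ wdeg q u := by
  rcases eq_or_ne d u with rfl | hne
  · exact le_rfl
  · exact (h.2 d hd hne).le

theorem coeff_mul_of_hasWLead {f g : MvPolynomial (Fin 2) k} {u d : Fin 2 →₀ ℕ}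
    (hg : HasWLead q g u) (hf : ∀ v ∈ f.support, wdeg q v + wdeg q u ≤ wdeg q d) :
    coeff d (f * g) = if u ≤ d then coeff (d - u) f * coeff u g else 0 := by
  have hrest : coeff d (f * (g - monomial u (coeff u g))) = 0 := by
    rw [coeff_mul]
    refine Finset.sum_eq_zero fun ⟨v, e⟩ hve => ?_
    rw [Finset.HasAntidiagonal.mem_antidiagonal] at hve
    dsimp only at hve ⊢
    by_cases hv : v ∈ f.support
    · have h1 := hf v hv
      rw [← hve, wdeg_add] at h1
      rcases eq_or_ne e u with rfl | hne
      · simp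
      · have : e ∉ g.support := fun he => by
          have := hg.2 e he hne
          omega
        rw [notMem_support_iff] at this
        simp [this, coeff_monomial, hne.symm]
    · rw [notMem_support_iff.mp hv, zero_mul]
  have : f * g = f * monomial u (coeff u g) + f * (g - monomial u (coeff u g)) := by ring
  rw [this, coeff_add, hrest, add_zero, coeff_mul_monomial']

theorem exists_of_mem_support_mul {f g : MvPolynomial (Fin 2) k} {d : Fin 2 →₀ ℕ}
    (hd : d ∈ (f * g).support) : ∃ v ∈ f.support, ∃ e ∈ g.support, v + e = d := by
  classical
  exact Finset.mem_add.mp (support_mul f g hd)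

theorem HasWLead.mul {f g : MvPolynomial (Fin 2) k} {u v : Fin 2 →₀ ℕ} (hf : HasWLead q f u)
    (hg : HasWLead q g v) : HasWLead q (f * g) (u + v) := by
  constructor
  · rw [coeff_mul_of_hasWLead hg, if_pos le_add_self, add_tsub_cancel_right]
    · exact mul_ne_zero hf.1 hg.1
    · intro e he
      rw [wdeg_add]
      exact Nat.add_le_add_right (hf.wdeg_le he) _
  · intro d hd hne
    obtain ⟨d₁, h₁, d₂, h₂, rfl⟩ := exists_of_mem_support_mul hd
    rw [wdeg_add, wdeg_add]
    rcases eq_or_ne d₁ u with rfl | hne₁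
    · have := hg.2 d₂ h₂ fun h => hne (by rw [h])
      omega
    · have := hf.2 d₁ h₁ hne₁
      have := hg.wdeg_le h₂
      omega

theorem hasWLead_monomial (u : Fin 2 →₀ ℕ) : HasWLead q (monomial u (1 : k)) u := by
  constructor
  · simp
  · intro d hd hne
    rw [mem_support_iff, coeff_monomial] at hd
    exact absurd (by simpa using hd) hne.symm

theorem hasWLead_one : HasWLead q (1 : MvPolynomial (Fin 2) k) 0 := hasWLead_monomial 0

theorem HasWLead.add_of_lt {f g : MvPolynomial (Fin 2) k} {u : Fin 2 →₀ ℕ} (hf : HasWLead q f u)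
    (hg : ∀ d ∈ g.support, wdeg q d < wdeg q u) : HasWLead q (f + g) u := by
  constructor
  · have : coeff u g = 0 := by
      by_contra h
      exact lt_irrefl _ (hg u (mem_support_iff.mpr h))
    simpa [this] using hf.1
  · intro d hd hne
    classical
    rcases Finset.mem_union.mp (support_add hd) with h | h
    · exact hf.2 d h hne
    · exact hg d h

theorem HasWLead.sub_monomial {f : MvPolynomial (Fin 2) k} {u d : Fin 2 →₀ ℕ}
    (hf : HasWLead q f u) (hd : d ∈ (f - monomial u (coeff u f)).support) :
    wdeg q d < wdeg q u := by
  rw [mem_support_iff, coeff_sub, coeff_monomial] at hd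
  split_ifs at hd with h
  · simp [h] at hd
  · exact hf.2 d (mem_support_iff.mpr (by simpa using hd)) (Ne.symm h)

theorem hasWLead_X_sub_C (hq : 0 < q) (i : Fin 2) (a : k) :
    HasWLead q (X i - C a : MvPolynomial (Fin 2) k) (Finsupp.single i 1) := by
  rw [sub_eq_add_neg, ← C_neg]
  refine HasWLead.add_of_lt (hasWLead_monomial _) fun d hd => ?_
  rw [mem_support_iff, coeff_C] at hd
  have : d = 0 := by
    by_contra h
    exact hd (if_neg (Ne.symm h))
  subst this
  fin_cases i <;> simp [wdeg, hq]

theorem hasWLead_prod_X_sub_C (hq : 0 < q) (i : Fin 2) (s : Finset k) :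
    HasWLead q (∏ a ∈ s, (X i - C a) : MvPolynomial (Fin 2) k) (Finsupp.single i s.card) := by
  classical
  induction s using Finset.induction_on with
  | empty => simpa using hasWLead_one
  | insert a s ha ih =>
    rw [Finset.prod_insert ha, Finset.card_insert_of_notMem ha, add_comm s.card,
      Finsupp.single_add]
    exact (hasWLead_X_sub_C hq i a).mul ih

theorem exists_hasWLead {f : MvPolynomial (Fin 2) k} (hf : f ≠ 0)
    (hinj : ∀ d ∈ f.support, d 0 ≤ q) : ∃ u ∈ f.support, HasWLead q f u := by
  obtain ⟨u, hu, hmax⟩ := Finset.exists_max_image f.support (wdeg q) (support_nonempty.mpr hf)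
  refine ⟨u, hu, mem_support_iff.mp hu, fun d hd hne => ?_⟩
  refine lt_of_le_of_ne (hmax d hd) fun h => hne ?_
  exact eq_of_wdeg_eq (hinj d hd) (hinj u hu) h

/-- Division by elements of `N` that lead with the monomials outside `S`. -/
theorem restrictSupport_le_sup (N : Submodule k (MvPolynomial (Fin 2) k)) (S : Set (Fin 2 →₀ ℕ))
    (h : ∀ d ∉ S, ∃ g ∈ N, HasWLead q g d) (n : ℕ) :
    restrictSupport k {d | wdeg q d < n} ≤ N ⊔ restrictSupport k {d | d ∈ S ∧ wdeg q d < n} := by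
  induction n with
  | zero => simp [restrictSupport_eq_span]
  | succ n ih =>
    have mono : N ⊔ restrictSupport k {d | d ∈ S ∧ wdeg q d < n} ≤
        N ⊔ restrictSupport k {d | d ∈ S ∧ wdeg q d < n + 1} :=
      sup_le_sup_left (restrictSupport_mono _ (fun d (hd : d ∈ S ∧ wdeg q d < n) =>
        (⟨hd.1, Nat.lt_succ_of_lt hd.2⟩ : d ∈ S ∧ wdeg q d < n + 1))) _
    conv_lhs => rw [restrictSupport_eq_span]
    rw [Submodule.span_le]
    rintro _ ⟨d, hd, rfl⟩
    have hd : wdeg q d < n + 1 := hd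
    by_cases hS : d ∈ S
    · exact Submodule.mem_sup_right ((monomial_mem_restrictSupport _).mpr (Or.inl ⟨hS, hd⟩))
    obtain ⟨g, hgN, hg⟩ := h d hS
    -- Everything below the lead of `g` has smaller weight, so the remainder respects the same
    -- weight bound as the dividend.
    have hsub : g - monomial d (coeff d g) ∈ restrictSupport k {d | wdeg q d < n} := by
      rw [mem_restrictSupport_iff]
      intro e he
      have := hg.sub_monomial he
      change wdeg q e < n
      omega
    have hmem := Submodule.sub_mem _ (Submodule.mem_sup_left hgN) (mono (ih hsub))
    rw [sub_sub_cancel] at hmem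
    have := Submodule.smul_mem _ (coeff d g)⁻¹ hmem
    rw [smul_monomial, smul_eq_mul, inv_mul_cancel₀ hg.1] at this
    exact this

theorem exists_restrictSupport_wdeg_lt (q : ℕ) (f : MvPolynomial (Fin 2) k) :
    ∃ n, f ∈ restrictSupport k {d | wdeg q d < n} := by
  refine ⟨f.support.sup (wdeg q) + 1, ?_⟩
  rw [mem_restrictSupport_iff]
  intro d hd
  exact Nat.lt_succ_of_le (Finset.le_sup (f := wdeg q) hd)

theorem exists_lead_mul {f : MvPolynomial (Fin 2) k} {u d : Fin 2 →₀ ℕ} (hf : HasWLead q f u)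
    (hd : u ≤ d) : HasWLead q (monomial (d - u) 1 * f) d := by
  have := (hasWLead_monomial (k := k) (q := q) (d - u)).mul hf
  rwa [tsub_add_cancel_of_le hd] at this

/-- The exponents of the monomials `x ^ r * y ^ s` with `r < a` and `s < b`. -/
def box (a b : ℕ) : Set (Fin 2 →₀ ℕ) := {d | d 0 < a ∧ d 1 < b}

theorem restrictSupport_le_span_sup_box {F G : MvPolynomial (Fin 2) k} {a b : ℕ}
    (hF : HasWLead q F (expXY a 0)) (hG : HasWLead q G (expXY 0 b)) (n : ℕ) :
    restrictSupport k {d | wdeg q d < n} ≤ (Ideal.span {F, G}).restrictScalars k ⊔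
      restrictSupport k {d | d ∈ box a b ∧ wdeg q d < n} := by
  refine restrictSupport_le_sup _ _ (fun d hd => ?_) n
  by_cases ha : a ≤ d 0
  · exact ⟨_, Ideal.mul_mem_left _ _ (Ideal.subset_span (by simp)),
      exists_lead_mul hF (exp_le (by simpa using ha) (by simp))⟩
  · have hb : b ≤ d 1 := by
      by_contra hb
      exact hd ⟨by omega, by omega⟩
    exact ⟨_, Ideal.mul_mem_left _ _ (Ideal.subset_span (by simp)),
      exists_lead_mul hG (exp_le (by simp) (by simpa using hb))⟩

/-- Pure powers of different variables are coprime, so after reducing `A` modulo `y ^ b` the top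
terms of the two products cannot cancel, and an uncancelled top term lies outside the box. Descent
on a common weight bound for both products kills `A` and `B`. -/
theorem eq_zero_of_mul_add_mul_mem_box {F G A B : MvPolynomial (Fin 2) k} {a b : ℕ}
    (hF : HasWLead q F (expXY a 0)) (hG : HasWLead q G (expXY 0 b))
    (hA : ∀ d ∈ A.support, d 1 < b) (hAB : A * F + B * G ∈ restrictSupport k (box a b)) :
    A * F + B * G = 0 := by
  rw [mem_restrictSupport_iff] at hAB
  suffices key : ∀ n, (∀ d ∈ A.support, wdeg q d + wdeg q (expXY a 0) < n) →
      (∀ d ∈ B.support, wdeg q d + wdeg q (expXY 0 b) < n) → A = 0 ∧ B = 0 by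
    obtain ⟨n₁, h₁⟩ := exists_restrictSupport_wdeg_lt q A
    obtain ⟨n₂, h₂⟩ := exists_restrictSupport_wdeg_lt q B
    obtain ⟨rfl, rfl⟩ := key (n₁ + n₂ + wdeg q (expXY a 0) + wdeg q (expXY 0 b))
      (fun d hd => by have : wdeg q d < n₁ := h₁ hd; omega)
      (fun d hd => by have : wdeg q d < n₂ := h₂ hd; omega)
    simp
  intro n
  induction n with
  | zero =>
    intro h₁ h₂
    constructor
    · by_contra h
      obtain ⟨d, hd⟩ := support_nonempty.mpr h
      exact absurd (h₁ d hd) (by omega)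
    · by_contra h
      obtain ⟨d, hd⟩ := support_nonempty.mpr h
      exact absurd (h₂ d hd) (by omega)
  | succ n ih =>
    intro h₁ h₂
    have hB' : ∀ d ∈ B.support, wdeg q d + wdeg q (expXY 0 b) < n := by
      intro d hd
      by_contra hlt
      have hn : wdeg q (d + expXY 0 b) = n := by
        have := h₂ d hd
        rw [wdeg_add]
        omega
      -- A contribution of `A * F` here would come from a monomial of `A` with `y`-exponent at least
      -- `b`.
      have c₁ : coeff (d + expXY 0 b) (A * F) = 0 := by
        rw [coeff_mul_of_hasWLead hF fun v hv => by have := h₁ v hv; omega]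
        split_ifs
        · rw [notMem_support_iff.mp, zero_mul]
          intro hmem
          simpa using hA _ hmem
        · rfl
      have c₂ : coeff (d + expXY 0 b) (B * G) = coeff d B * coeff (expXY 0 b) G := by
        rw [coeff_mul_of_hasWLead hG fun v hv => by have := h₂ v hv; omega, if_pos le_add_self,
          add_tsub_cancel_right]
      have hmem : d + expXY 0 b ∈ (A * F + B * G).support := by
        rw [mem_support_iff, coeff_add, c₁, c₂, zero_add]
        exact mul_ne_zero (mem_support_iff.mp hd) hG.1
      have := (hAB hmem).2
      simp at this
    refine ih (fun d hd => ?_) hB'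
    by_contra hlt
    have hn : wdeg q (d + expXY a 0) = n := by
      have := h₁ d hd
      rw [wdeg_add]
      omega
    have c₁ : coeff (d + expXY a 0) (A * F) = coeff d A * coeff (expXY a 0) F := by
      rw [coeff_mul_of_hasWLead hF fun v hv => by have := h₁ v hv; omega, if_pos le_add_self,
        add_tsub_cancel_right]
    have c₂ : coeff (d + expXY a 0) (B * G) = 0 := by
      by_contra h
      obtain ⟨v, hv, e, he, hve⟩ := exists_of_mem_support_mul (mem_support_iff.mpr h)
      have := hB' v hv
      have := hG.wdeg_le he
      rw [← hve, wdeg_add] at hn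
      omega
    have hmem : d + expXY a 0 ∈ (A * F + B * G).support := by
      rw [mem_support_iff, coeff_add, c₁, c₂, add_zero]
      exact mul_ne_zero (mem_support_iff.mp hd) hF.1
    have := (hAB hmem).1
    simp at this

/-- The monomials of the box are linearly independent modulo two polynomials that lead with pure
powers of the two variables. -/
theorem eq_zero_of_mem_span_of_mem_box {F G P : MvPolynomial (Fin 2) k} {a b : ℕ}
    (hF : HasWLead q F (expXY a 0)) (hG : HasWLead q G (expXY 0 b))
    (hP : P ∈ Ideal.span {F, G}) (hbox : P ∈ restrictSupport k (box a b)) : P = 0 := by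
  obtain ⟨A, B, rfl⟩ := Ideal.mem_span_pair.mp hP
  obtain ⟨n, hn⟩ := exists_restrictSupport_wdeg_lt q A
  -- The coefficient `A` is reduced modulo `G`; the part divisible by `G` is moved into the
  -- coefficient of `G`.
  have hred := restrictSupport_le_sup (q := q) ((Ideal.span {G}).restrictScalars k) {d | d 1 < b}
    (fun d hd => ⟨_, Ideal.mul_mem_left _ _ (Ideal.subset_span (by simp)),
      exists_lead_mul hG (exp_le (by simp) (by simpa using hd))⟩) n hn
  obtain ⟨N, hN, A₀, hA₀, rfl⟩ := Submodule.mem_sup.mp hred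
  obtain ⟨Q, rfl⟩ := Ideal.mem_span_singleton'.mp hN
  have heq : (Q * G + A₀) * F + B * G = A₀ * F + (B + Q * F) * G := by ring
  rw [heq] at hbox ⊢
  exact eq_zero_of_mul_add_mul_mem_box hF hG (fun d hd => (hA₀ hd).1) hbox

end WeightedLead

/-! ### Evaluation on sets of points of the curve -/

section Evaluation

variable {k : Type*} [Field k] {q : ℕ}

theorem evalE_apply (f : MvPolynomial (Fin 2) k) (P : E k q) :
    evalE k q f P = eval (P : Fin 2 → k) f := by
  simp [evalE]

theorem V_eq_restrictSupport (m : ℕ) :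
    V k q m = restrictSupport k {d | wdeg q d < m + 1} := by
  rw [V, restrictSupport_eq_span]
  congr 1
  ext f
  constructor
  · rintro ⟨e, he, rfl⟩
    exact ⟨e, he, rfl⟩
  · rintro ⟨e, he, rfl⟩
    exact ⟨e, he, rfl⟩

/-- The values of a polynomial at the points of `D`. -/
noncomputable def evalOn (D : Finset (E k q)) : MvPolynomial (Fin 2) k →ₗ[k] (D → k) :=
  LinearMap.funLeft k k (Subtype.val : D → E k q) ∘ₗ evalE k q

theorem evalOn_apply (D : Finset (E k q)) (f : MvPolynomial (Fin 2) k) (P : D) :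
    evalOn D f P = eval (P.1 : Fin 2 → k) f := evalE_apply f P.1

theorem mem_idealOf {D : Finset (E k q)} {f : MvPolynomial (Fin 2) k} :
    f ∈ idealOf D ↔ ∀ P ∈ D, eval (P : Fin 2 → k) f = 0 := by
  simp [idealOf, mem_vanishingIdeal_iff]

theorem evalOn_eq_zero_iff {D : Finset (E k q)} {f : MvPolynomial (Fin 2) k} :
    evalOn D f = 0 ↔ f ∈ idealOf D := by
  rw [mem_idealOf, funext_iff]
  simp only [evalOn_apply, Pi.zero_apply]
  exact ⟨fun h P hP => h ⟨P, hP⟩, fun h P => h P.1 P.2⟩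

theorem hermitianPoly_mem_idealOf (D : Finset (E k q)) : hermitianPoly k q ∈ idealOf D :=
  mem_idealOf.mpr fun P _ => P.2

theorem evalE_surjective [Finite k] : Function.Surjective (evalE k q) := by
  classical
  have := Fintype.ofFinite k
  intro v
  have h : (fun P : Fin 2 → k => if hP : P ∈ E k q then v ⟨P, hP⟩ else 0) ∈
      (restrictDegree (Fin 2) k (Fintype.card k - 1)).map (evalₗ k (Fin 2)) := by
    rw [map_restrict_dom_evalₗ]
    trivial
  obtain ⟨f, -, hf⟩ := h
  refine ⟨f, funext fun P => ?_⟩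
  rw [evalE_apply]
  have := congrFun hf P
  rw [evalₗ_apply] at this
  simpa using this

theorem evalOn_surjective [Finite k] (D : Finset (E k q)) : Function.Surjective (evalOn D) := by
  rw [evalOn, LinearMap.coe_comp]
  exact (LinearMap.funLeft_surjective_of_injective k k _ Subtype.val_injective).comp
    evalE_surjective

theorem finrank_restrictSupport (S : Finset (Fin 2 →₀ ℕ)) :
    Module.finrank k (restrictSupport k (S : Set (Fin 2 →₀ ℕ))) = S.card := by
  rw [Module.finrank_eq_card_basis (basisRestrictSupport k (S : Set (Fin 2 →₀ ℕ)))]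
  simp

instance (S : Finset (Fin 2 →₀ ℕ)) :
    Module.Finite k (restrictSupport k (S : Set (Fin 2 →₀ ℕ))) :=
  Module.Finite.of_basis (basisRestrictSupport k (S : Set (Fin 2 →₀ ℕ)))

/-- The values at `D` of the polynomials supported in `S`. -/
noncomputable def evalRestrict (D : Finset (E k q)) (S : Finset (Fin 2 →₀ ℕ)) :
    restrictSupport k (S : Set (Fin 2 →₀ ℕ)) →ₗ[k] (D → k) :=
  (evalOn D).domRestrict _

theorem evalRestrict_injective {D : Finset (E k q)} {S : Finset (Fin 2 →₀ ℕ)}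
    (h : ∀ f ∈ restrictSupport k (S : Set (Fin 2 →₀ ℕ)), f ∈ idealOf D → f = 0) :
    Function.Injective (evalRestrict D S) := by
  rw [injective_iff_map_eq_zero]
  rintro ⟨f, hf⟩ h0
  exact Subtype.ext (h f hf (evalOn_eq_zero_iff.mp h0))

theorem card_le_card_of_evalRestrict_injective {D : Finset (E k q)} {S : Finset (Fin 2 →₀ ℕ)}
    (h : Function.Injective (evalRestrict D S)) : S.card ≤ D.card := by
  have := LinearMap.finrank_le_finrank_of_injective h
  rwa [finrank_restrictSupport, Module.finrank_fintype_fun_eq_card, Fintype.card_coe] at this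

theorem card_le_card_of_evalRestrict_surjective {D : Finset (E k q)} {S : Finset (Fin 2 →₀ ℕ)}
    (h : Function.Surjective (evalRestrict D S)) : D.card ≤ S.card := by
  have := LinearMap.finrank_le_finrank_of_surjective h
  rwa [finrank_restrictSupport, Module.finrank_fintype_fun_eq_card, Fintype.card_coe] at this

theorem evalRestrict_injective_iff_surjective {D : Finset (E k q)} {S : Finset (Fin 2 →₀ ℕ)}
    (h : S.card = D.card) :
    Function.Injective (evalRestrict D S) ↔ Function.Surjective (evalRestrict D S) := by
  refine LinearMap.injective_iff_surjective_of_finrank_eq_finrank ?_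
  rw [finrank_restrictSupport, Module.finrank_fintype_fun_eq_card, Fintype.card_coe, h]

theorem exists_sub_mem_idealOf {D : Finset (E k q)} {S : Finset (Fin 2 →₀ ℕ)}
    (h : Function.Surjective (evalRestrict D S)) (f : MvPolynomial (Fin 2) k) :
    ∃ p ∈ restrictSupport k (S : Set (Fin 2 →₀ ℕ)), f - p ∈ idealOf D := by
  obtain ⟨⟨p, hp⟩, hpf⟩ := h (evalOn D f)
  refine ⟨p, hp, evalOn_eq_zero_iff.mp ?_⟩
  rw [map_sub, sub_eq_zero]
  exact hpf.symm

theorem expXY_injective : Function.Injective fun p : ℕ × ℕ => expXY p.1 p.2 := by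
  intro p p' h
  have h0 := DFunLike.congr_fun h 0
  have h1 := DFunLike.congr_fun h 1
  simp only [expXY_apply_zero, expXY_apply_one] at h0 h1
  exact Prod.ext h0 h1

/-- The box of exponents as a finite set. -/
noncomputable def boxFinset (a b : ℕ) : Finset (Fin 2 →₀ ℕ) :=
  (Finset.range a ×ˢ Finset.range b).map ⟨fun p => expXY p.1 p.2, expXY_injective⟩

theorem card_boxFinset (a b : ℕ) : (boxFinset a b).card = a * b := by
  simp [boxFinset]

theorem mem_boxFinset {a b : ℕ} {d : Fin 2 →₀ ℕ} : d ∈ boxFinset a b ↔ d 0 < a ∧ d 1 < b := by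
  simp only [boxFinset, Finset.mem_map, Finset.mem_product, Finset.mem_range,
    Function.Embedding.coeFn_mk, Prod.exists]
  constructor
  · rintro ⟨r, s, h, rfl⟩
    simpa using h
  · intro h
    exact ⟨d 0, d 1, h, exp_ext (by simp) (by simp)⟩

theorem coe_boxFinset (a b : ℕ) : (boxFinset a b : Set (Fin 2 →₀ ℕ)) = box a b := by
  ext d
  exact mem_boxFinset

/-! ### Ideals generated by two polynomials with pure-power leads. -/

section CompleteIntersection

variable {F G : MvPolynomial (Fin 2) k} {a b : ℕ} {D : Finset (E k q)}

theorem exists_box_sub_mem_span (hF : HasWLead q F (expXY a 0)) (hG : HasWLead q G (expXY 0 b))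
    (f : MvPolynomial (Fin 2) k) :
    ∃ p ∈ restrictSupport k (boxFinset a b : Set (Fin 2 →₀ ℕ)), f - p ∈ Ideal.span {F, G} := by
  obtain ⟨n, hn⟩ := exists_restrictSupport_wdeg_lt q f
  obtain ⟨N, hN, p, hp, rfl⟩ :=
    Submodule.mem_sup.mp (restrictSupport_le_span_sup_box hF hG n hn)
  refine ⟨p, ?_, by simpa using hN⟩
  rw [coe_boxFinset]
  exact fun d hd => (hp hd).1

theorem evalRestrict_box_surjective [Finite k] (hF : HasWLead q F (expXY a 0))
    (hG : HasWLead q G (expXY 0 b)) (hFG : Ideal.span {F, G} ≤ idealOf D) :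
    Function.Surjective (evalRestrict D (boxFinset a b)) := by
  intro v
  obtain ⟨f, rfl⟩ := evalOn_surjective D v
  obtain ⟨p, hp, hfp⟩ := exists_box_sub_mem_span hF hG f
  refine ⟨⟨p, hp⟩, ?_⟩
  have := evalOn_eq_zero_iff.mpr (hFG hfp)
  rw [map_sub, sub_eq_zero] at this
  exact this.symm

/-- The box spans the quotient by `⟨F, G⟩`, which surjects onto the functions on `D`. When the box
has as many elements as `D`, no box polynomial is lost, so both quotients coincide. -/
theorem idealOf_eq_span [Finite k] (hF : HasWLead q F (expXY a 0))
    (hG : HasWLead q G (expXY 0 b)) (hFG : Ideal.span {F, G} ≤ idealOf D)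
    (hD : D.card = a * b) : idealOf D = Ideal.span {F, G} := by
  refine le_antisymm (fun f hf => ?_) hFG
  have hinj := (evalRestrict_injective_iff_surjective
    (by rw [card_boxFinset, hD])).mpr (evalRestrict_box_surjective hF hG hFG)
  obtain ⟨p, hp, hfp⟩ := exists_box_sub_mem_span hF hG f
  have hpD : p ∈ idealOf D := by
    have := sub_mem hf (hFG hfp)
    rwa [sub_sub_cancel] at this
  have : (⟨p, hp⟩ : restrictSupport k (boxFinset a b : Set (Fin 2 →₀ ℕ))) = 0 :=
    hinj (by rw [map_zero]; exact evalOn_eq_zero_iff.mpr hpD)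
  have hp0 : p = 0 := congrArg Subtype.val this
  simpa [hp0] using hfp

theorem card_eq_of_idealOf_eq_span [Finite k] (hF : HasWLead q F (expXY a 0))
    (hG : HasWLead q G (expXY 0 b)) (hFG : idealOf D = Ideal.span {F, G}) : D.card = a * b := by
  rw [← card_boxFinset a b]
  refine le_antisymm
    (card_le_card_of_evalRestrict_surjective (evalRestrict_box_surjective hF hG hFG.ge))
    (card_le_card_of_evalRestrict_injective (evalRestrict_injective fun f hf hfD => ?_))
  rw [coe_boxFinset] at hf
  exact eq_zero_of_mem_span_of_mem_box hF hG (hFG ▸ hfD) hf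

/-- Reduction does not raise the weight, so polynomials in `V_m` never produce the corner `x ^ a * y
^ b`. The values of `V_m` on `D` then span fewer than `D.card` dimensions, and a functional
annihilating them is a codeword. -/
theorem exists_codeword [Finite k] {m : ℕ} (hF : HasWLead q F (expXY (a + 1) 0))
    (hG : HasWLead q G (expXY 0 (b + 1))) (hFG : Ideal.span {F, G} ≤ idealOf D)
    (hD : D.card = (a + 1) * (b + 1)) (hm : m < a * q + b * (q + 1)) :
    ∃ c ∈ code k q m, c ≠ 0 ∧ Function.support c ⊆ (D : Set (E k q)) := by
  classical
  set S := (boxFinset (a + 1) (b + 1)).erase (expXY a b) with hS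
  have hcard : S.card < D.card := by
    rw [hS, Finset.card_erase_of_mem (mem_boxFinset.mpr (by simp)), card_boxFinset, hD]
    have : 0 < (a + 1) * (b + 1) := by positivity
    omega
  have hmap : (V k q m).map (evalOn D) ≤ LinearMap.range (evalRestrict D S) := by
    rintro _ ⟨f, hf, rfl⟩
    rw [SetLike.mem_coe, V_eq_restrictSupport] at hf
    obtain ⟨N, hN, p, hp, rfl⟩ :=
      Submodule.mem_sup.mp (restrictSupport_le_span_sup_box hF hG _ hf)
    refine ⟨⟨p, fun d hd => ?_⟩, ?_⟩
    · obtain ⟨h₁, h₂⟩ := hp hd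
      rw [Finset.mem_coe, hS, Finset.mem_erase]
      refine ⟨?_, mem_boxFinset.mpr h₁⟩
      rintro rfl
      rw [wdeg_expXY] at h₂
      omega
    · rw [map_add, evalOn_eq_zero_iff.mpr (hFG hN), zero_add]
      rfl
  have hlt : LinearMap.range (evalRestrict D S) < ⊤ := by
    rw [lt_top_iff_ne_top]
    intro htop
    have := card_le_card_of_evalRestrict_surjective (LinearMap.range_eq_top.mp htop)
    omega
  obtain ⟨l, hl0, hl⟩ := Submodule.exists_le_ker_of_lt_top _ hlt
  have hlsum : ∀ v : D → k, l v = ∑ P, v P * l (Pi.single P 1) := by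
    intro v
    conv_lhs => rw [← Finset.univ_sum_single v, map_sum]
    refine Finset.sum_congr rfl fun P _ => ?_
    rw [← smul_eq_mul, ← map_smul, ← Pi.single_smul, smul_eq_mul, mul_one]
  refine ⟨fun P => if hP : P ∈ D then l (Pi.single ⟨P, hP⟩ 1) else 0, ?_, ?_, ?_⟩
  · rintro _ ⟨f, hf, rfl⟩
    have h0 : l (evalOn D f) = 0 := hl (hmap ⟨f, hf, rfl⟩)
    rw [hlsum] at h0
    refine Eq.trans ?_ h0
    rw [dotProduct, ← Finset.sum_subset (Finset.subset_univ D), ← Finset.sum_coe_sort D]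
    · refine Finset.sum_congr rfl fun P _ => ?_
      rw [dif_pos P.2]
      rfl
    · intro P _ hP
      rw [dif_neg hP, mul_zero]
  · intro h
    refine hl0 (LinearMap.ext fun v => ?_)
    rw [hlsum]
    refine Finset.sum_eq_zero fun P _ => ?_
    have := congrFun h P.1
    rw [dif_pos P.2] at this
    rw [this]
    exact mul_zero _
  · intro P hP
    by_contra h
    exact hP (dif_neg h)

end CompleteIntersection

end Evaluation

/-! ### The order bound -/

section OrderBound

variable {k : Type*} [Field k] [Finite k] {q : ℕ}

/-- The functional `f ↦ ∑ P, f(P) c(P)` defined by a word `c`. -/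
noncomputable def pairing (c : E k q → k) : MvPolynomial (Fin 2) k →ₗ[k] k :=
  (dotProductBilin k k).flip c ∘ₗ evalE k q

theorem pairing_apply (c : E k q → k) (f : MvPolynomial (Fin 2) k) :
    pairing c f = evalE k q f ⬝ᵥ c := rfl

theorem pairing_eq_zero_of_mem_idealOf {c : E k q → k} {D : Finset (E k q)}
    (hc : Function.support c ⊆ D) {f : MvPolynomial (Fin 2) k} (hf : f ∈ idealOf D) :
    pairing c f = 0 := by
  rw [pairing_apply]
  refine Finset.sum_eq_zero fun P _ => ?_
  by_cases hP : P ∈ D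
  · rw [evalE_apply, mem_idealOf.mp hf P hP, zero_mul]
  · rw [Function.notMem_support.mp fun h => hP (hc h), mul_zero]

/-- `n` is the least weighted degree that is not orthogonal to `c`. -/
def IsOrder (c : E k q → k) (n : ℕ) : Prop :=
  (∀ d, wdeg q d < n → pairing c (monomial d 1) = 0) ∧
    ∀ d, wdeg q d = n → pairing c (monomial d 1) ≠ 0

theorem pairing_eq_zero_of_restrictSupport {c : E k q → k} {n : ℕ}
    (hc : ∀ d, wdeg q d < n → pairing c (monomial d 1) = 0) {f : MvPolynomial (Fin 2) k}
    (hf : f ∈ restrictSupport k {d | wdeg q d < n}) : pairing c f = 0 := by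
  suffices restrictSupport k {d | wdeg q d < n} ≤ LinearMap.ker (pairing c) from this hf
  rw [restrictSupport_eq_span, Submodule.span_le]
  rintro _ ⟨d, hd, rfl⟩
  exact hc d hd

/-- Modulo `H`, `x ^ (q + 1)` is `y ^ q + y`: the term `y ^ q` keeps the weight, while `y` lowers it
and is killed by the pairing. Hence the pairing depends only on the weight at the first weight where
it can be nonzero. -/
theorem exists_rep_of_pairing (hq : 2 ≤ q) {c : E k q → k} {n : ℕ}
    (hc : ∀ d, wdeg q d < n → pairing c (monomial d 1) = 0) (d : Fin 2 →₀ ℕ)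
    (hd : wdeg q d = n) : ∃ e : Fin 2 →₀ ℕ, e 0 ≤ q ∧ wdeg q e = n ∧
      pairing c (monomial d 1) = pairing c (monomial e 1) := by
  induction hN : d 0 using Nat.strong_induction_on generalizing d with
  | _ N ih =>
    by_cases h : N ≤ q
    · exact ⟨d, by omega, hd, rfl⟩
    have hlow : wdeg q (expXY (d 0 - (q + 1)) (d 1 + q)) = n := by
      obtain ⟨t, ht⟩ := Nat.exists_eq_add_of_le (show q + 1 ≤ d 0 by omega)
      rw [← hd, wdeg_expXY, wdeg, ht, Nat.add_sub_cancel_left]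
      ring
    obtain ⟨e, he, hen, hpe⟩ := ih _ (by rw [expXY_apply_zero]; omega) _ hlow rfl
    refine ⟨e, he, hen, ?_⟩
    rw [← hpe, ← sub_eq_zero]
    have h0 := pairing_eq_zero_of_mem_idealOf (c := c) (by simp) (Ideal.mul_mem_left _
        (monomial (expXY (d 0 - (q + 1)) (d 1)) (1 : k)) (hermitianPoly_mem_idealOf Finset.univ))
    have hX : monomial (expXY (d 0 - (q + 1)) (d 1)) (1 : k) * hermitianPoly k q =
        monomial d 1 - monomial (expXY (d 0 - (q + 1)) (d 1 + q)) 1 -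
          monomial (expXY (d 0 - (q + 1)) (d 1 + 1)) 1 := by
      have h1 : (X 1 : MvPolynomial (Fin 2) k) = monomial (Finsupp.single 1 1) 1 := rfl
      rw [hermitianPoly, X_pow_eq_monomial, X_pow_eq_monomial, h1, mul_sub, mul_sub,
        monomial_mul, monomial_mul, monomial_mul, mul_one]
      congr 3
      · congr 1
        exact exp_ext (by simp; omega) (by simp)
      · congr 1
        exact exp_ext (by simp) (by simp)
      · exact exp_ext (by simp) (by simp)
    rw [hX, map_sub, map_sub, hc (expXY (d 0 - (q + 1)) (d 1 + 1)) _, sub_zero] at h0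
    · exact h0
    · rw [← hlow, wdeg_expXY, wdeg_expXY]
      nlinarith

theorem exists_isOrder (hq : 2 ≤ q) {m : ℕ} {c : E k q → k} (hc : c ∈ code k q m) (h0 : c ≠ 0) :
    ∃ r s, r ≤ q ∧ m < r * q + s * (q + 1) ∧ IsOrder c (r * q + s * (q + 1)) := by
  classical
  have hex : ∃ n, ∃ d, wdeg q d = n ∧ pairing c (monomial d 1) ≠ 0 := by
    by_contra! hall
    obtain ⟨P, hP⟩ := Function.ne_iff.mp h0
    obtain ⟨f, hf⟩ := evalE_surjective (k := k) (q := q) (Pi.single P 1)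
    obtain ⟨n, hn⟩ := exists_restrictSupport_wdeg_lt q f
    have := pairing_eq_zero_of_restrictSupport (fun d _ => hall _ d rfl) hn
    rw [pairing_apply, hf, single_dotProduct, one_mul] at this
    exact hP this
  obtain ⟨d, hd, hdc⟩ := Nat.find_spec hex
  have hlt : ∀ d, wdeg q d < Nat.find hex → pairing c (monomial d 1) = 0 := by
    intro d hd
    by_contra h
    exact Nat.find_min hex hd ⟨d, rfl, h⟩
  obtain ⟨e, he, hen, hpe⟩ := exists_rep_of_pairing hq hlt d hd
  have hwe : e 0 * q + e 1 * (q + 1) = Nat.find hex := hen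
  refine ⟨e 0, e 1, he, ?_, ?_, ?_⟩
  · by_contra hle
    refine hdc (hc _ ⟨_, ?_, rfl⟩)
    rw [SetLike.mem_coe, V_eq_restrictSupport]
    exact (monomial_mem_restrictSupport _).mpr (Or.inl (show wdeg q d < m + 1 by omega))
  · rw [hwe]
    exact hlt
  · intro d' hd'
    obtain ⟨e', he', hen', hpe'⟩ := exists_rep_of_pairing hq hlt d' (hd'.trans hwe)
    rw [hpe', eq_of_wdeg_eq he' he (hen'.trans hen.symm), ← hpe]
    exact hdc

/-- No polynomial vanishing on the support of `c` leads with a divisor of the order of `c`. -/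
theorem IsOrder.not_hasWLead {c : E k q → k} {n : ℕ} (hn : IsOrder c n) {D : Finset (E k q)}
    (hc : Function.support c ⊆ D) {g : MvPolynomial (Fin 2) k} (hg : g ∈ idealOf D)
    {u v : Fin 2 →₀ ℕ} (huv : wdeg q u + wdeg q v = n) : ¬ HasWLead q g u := by
  intro hu
  have hlead := hu.mul (hasWLead_monomial (k := k) (q := q) v)
  have h0 := pairing_eq_zero_of_mem_idealOf hc (Ideal.mul_mem_right (monomial v (1 : k)) _ hg)
  set h := g * monomial v (1 : k)
  -- Below its lead, `h` has weights less than `n`, where `c` is orthogonal to everything.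
  have hrest : pairing c (h - monomial (u + v) (coeff (u + v) h)) = 0 := by
    refine pairing_eq_zero_of_restrictSupport hn.1 ?_
    intro d hd
    have := hlead.sub_monomial hd
    rw [wdeg_add, huv] at this
    exact this
  rw [map_sub, h0, zero_sub, neg_eq_zero, ← mul_one (coeff (u + v) h), ← smul_eq_mul,
    ← smul_monomial, map_smul, smul_eq_zero] at hrest
  rcases hrest with hr | hr
  · exact hlead.1 hr
  · exact hn.2 _ (by rw [wdeg_add, huv]) hr

/-- Exponents `u` with `u 0 ≤ q` whose weighted degree divides that of `x ^ r * y ^ s`. -/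
noncomputable def divisorFinset (q r s : ℕ) : Finset (Fin 2 →₀ ℕ) :=
  ((Finset.range (r + 1) ×ˢ Finset.range (s + 1)).disjUnion
    (Finset.Ioc r q ×ˢ Finset.range (s + 1 - q)) (by
      rw [Finset.disjoint_left]
      intro p hp hp'
      simp only [Finset.mem_product, Finset.mem_range, Finset.mem_Ioc] at hp hp'
      omega)).map ⟨fun p => expXY p.1 p.2, expXY_injective⟩

theorem card_divisorFinset (q r s : ℕ) :
    (divisorFinset q r s).card = (r + 1) * (s + 1) + (q - r) * (s + 1 - q) := by
  simp only [divisorFinset, Finset.card_map, Finset.card_disjUnion, Finset.card_product,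
    Finset.card_range, Nat.card_Ioc]

theorem exists_of_mem_divisorFinset {r s : ℕ} (hr : r ≤ q) {u : Fin 2 →₀ ℕ}
    (hu : u ∈ divisorFinset q r s) :
    u 0 ≤ q ∧ ∃ v, wdeg q u + wdeg q v = r * q + s * (q + 1) := by
  obtain ⟨⟨i, j⟩, hij, rfl⟩ := Finset.mem_map.mp hu
  simp only [Finset.mem_disjUnion, Finset.mem_product, Finset.mem_range, Finset.mem_Ioc] at hij
  change expXY i j 0 ≤ q ∧ ∃ v, wdeg q (expXY i j) + wdeg q v = _
  rw [expXY_apply_zero]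
  rcases hij with ⟨hi, hj⟩ | ⟨hi, hj⟩
  · refine ⟨by omega, expXY (r - i) (s - j), ?_⟩
    obtain ⟨a, rfl⟩ := Nat.exists_eq_add_of_le (show i ≤ r by omega)
    obtain ⟨b, rfl⟩ := Nat.exists_eq_add_of_le (show j ≤ s by omega)
    simp only [wdeg_expXY, Nat.add_sub_cancel_left]
    ring
  -- Here `i > r`; the relation `w(y ^ q) = w(x ^ (q + 1))` trades `q` factors `y` for `q + 1`
  -- factors `x`.
  · refine ⟨by omega, expXY (r + (q + 1) - i) (s - (q + j)), ?_⟩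
    obtain ⟨a, ha⟩ := Nat.exists_eq_add_of_le (show i ≤ r + (q + 1) by omega)
    obtain ⟨b, rfl⟩ := Nat.exists_eq_add_of_le (show q + j ≤ s by omega)
    simp only [wdeg_expXY, ha, Nat.add_sub_cancel_left]
    have : i * q + a * q = (r + (q + 1)) * q := by rw [ha]; ring
    linarith

theorem IsOrder.eq_zero_of_mem_idealOf {c : E k q → k} {r s : ℕ} (hr : r ≤ q)
    (hn : IsOrder c (r * q + s * (q + 1))) {D : Finset (E k q)}
    (hc : Function.support c ⊆ D) {g : MvPolynomial (Fin 2) k} (hg : g ∈ idealOf D)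
    (hS : g ∈ restrictSupport k (divisorFinset q r s : Set (Fin 2 →₀ ℕ))) : g = 0 := by
  by_contra h0
  obtain ⟨u, hu, hlead⟩ := exists_hasWLead h0 fun d hd =>
    (exists_of_mem_divisorFinset hr (hS hd)).1
  obtain ⟨v, hv⟩ := (exists_of_mem_divisorFinset hr (hS hu)).2
  exact hn.not_hasWLead hc hg hv hlead

theorem IsOrder.card_le {c : E k q → k} {r s : ℕ} (hr : r ≤ q)
    (hn : IsOrder c (r * q + s * (q + 1))) {D : Finset (E k q)}
    (hc : Function.support c ⊆ D) :
    (r + 1) * (s + 1) + (q - r) * (s + 1 - q) ≤ D.card := by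
  rw [← card_divisorFinset]
  exact card_le_card_of_evalRestrict_injective
    (evalRestrict_injective fun f hf hfD => hn.eq_zero_of_mem_idealOf hr hc hfD hf)

theorem boxFinset_subset_divisorFinset (q r s : ℕ) :
    boxFinset (r + 1) (s + 1) ⊆ divisorFinset q r s := by
  unfold boxFinset divisorFinset
  rw [Finset.map_subset_map]
  intro p hp
  exact Finset.mem_disjUnion.mpr (Or.inl hp)

/-- When `D` attains the size of the box, box polynomials interpolate every function on `D`.
Reducing the monomial `u` gives an element of `I_D` whose lead is `u` or in the box, and the order
of `c` excludes the box. -/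
theorem IsOrder.exists_hasWLead_mem_idealOf {c : E k q → k} {r s : ℕ} (hr : r ≤ q)
    (hn : IsOrder c (r * q + s * (q + 1))) {D : Finset (E k q)}
    (hc : Function.support c ⊆ D) (hD : D.card = (r + 1) * (s + 1)) {u : Fin 2 →₀ ℕ}
    (hu : u 0 ≤ q) (hbox : u ∉ boxFinset (r + 1) (s + 1)) :
    ∃ g ∈ idealOf D, HasWLead q g u := by
  have hsub := boxFinset_subset_divisorFinset q r s
  have hsurj : Function.Surjective (evalRestrict D (boxFinset (r + 1) (s + 1))) :=
    (evalRestrict_injective_iff_surjective (by rw [card_boxFinset, hD])).mp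
      (evalRestrict_injective fun f hf hfD => hn.eq_zero_of_mem_idealOf hr hc hfD
        (restrictSupport_mono _ (Finset.coe_subset.mpr hsub) hf))
  obtain ⟨p, hp, hpD⟩ := exists_sub_mem_idealOf hsurj (monomial u (1 : k))
  have hmem : ∀ d ∈ (monomial u (1 : k) - p).support, d = u ∨ d ∈ boxFinset (r + 1) (s + 1) := by
    intro d hd
    by_cases h : d = u
    · exact Or.inl h
    · refine Or.inr (hp ?_)
      rw [mem_support_iff, coeff_sub, coeff_monomial, if_neg (Ne.symm h), zero_sub] at hd
      exact mem_support_iff.mpr (neg_ne_zero.mp hd)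
  have hne : monomial u (1 : k) - p ≠ 0 := by
    intro h
    have hc1 : coeff u (monomial u (1 : k) - p) = 0 := by rw [h, coeff_zero]
    have hcp : coeff u p = 0 := by
      by_contra hcp
      exact hbox (hp (mem_support_iff.mpr hcp))
    simp [hcp] at hc1
  obtain ⟨v, hv, hlead⟩ := exists_hasWLead (q := q) hne fun d hd => by
    rcases hmem d hd with rfl | h
    · exact hu
    · exact (exists_of_mem_divisorFinset hr (hsub h)).1
  refine ⟨_, hpD, ?_⟩
  rcases hmem v hv with rfl | h
  · exact hlead
  · obtain ⟨w, hw⟩ := (exists_of_mem_divisorFinset hr (hsub h)).2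
    exact absurd hlead (hn.not_hasWLead hc hpD hw)

end OrderBound

/-! ### Sets of points of the curve -/

section Points

variable {k : Type*} [Field k] {q : ℕ}

theorem add_pow_of_card_eq_sq [Finite k] (hq : Nat.card k = q ^ 2) (a b : k) :
    (a + b) ^ q = a ^ q + b ^ q := by
  have := Fintype.ofFinite k
  obtain ⟨p, hp⟩ := CharP.exists k
  obtain ⟨n, hpp, hn⟩ := FiniteField.card k p
  rw [Fintype.card_eq_nat_card, hq] at hn
  have : Fact p.Prime := ⟨hpp⟩
  -- Since `q` divides `q ^ 2 = p ^ n`, it is a power of the characteristic.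
  obtain ⟨j, -, rfl⟩ := (Nat.dvd_prime_pow hpp).mp (hn ▸ dvd_pow_self q two_ne_zero)
  exact add_pow_char_pow a b p j

theorem pow_sq_of_card_eq_sq [Finite k] (hq : Nat.card k = q ^ 2) (a : k) : (a ^ q) ^ q = a := by
  have := Fintype.ofFinite k
  rw [← pow_mul, ← sq, ← hq, ← Fintype.card_eq_nat_card, FiniteField.pow_card]

theorem two_le_of_card_eq_sq [Finite k] (hq : Nat.card k = q ^ 2) : 2 ≤ q := by
  have h1 : 1 < q ^ 2 := hq ▸ Finite.one_lt_card
  by_contra h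
  have : q = 0 ∨ q = 1 := by omega
  rcases this with rfl | rfl <;> simp at h1

theorem ncard_eval_eq_zero_le {p : Polynomial k} (hp : p ≠ 0) :
    {y : k | p.eval y = 0}.ncard ≤ p.natDegree := by
  classical
  have : {y : k | p.eval y = 0} = (p.roots.toFinset : Set k) := by
    ext y
    simp [hp]
  rw [this, Set.ncard_coe_finset]
  exact (Multiset.toFinset_card_le _).trans p.card_roots'

open Classical in
/-- The fibres of the trace `y ↦ y ^ q + y` over the subfield with `q` elements. -/
theorem card_trace_fiber [Fintype k] (hq : Nat.card k = q ^ 2) {a : k} (ha : a ^ q = a) :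
    (Finset.univ.filter fun y : k => y ^ q + y = a).card = q := by
  have hq2 := two_le_of_card_eq_sq hq
  let T : k →+ k :=
    { toFun := fun y => y ^ q + y
      map_zero' := by simp [show q ≠ 0 by omega]
      map_add' := fun x y => by
        change (x + y) ^ q + (x + y) = _
        rw [add_pow_of_card_eq_sq hq]
        ring }
  have hker : Nat.card T.ker ≤ q := by
    have hne : (Polynomial.X ^ q + Polynomial.X : Polynomial k).natDegree = q := by
      rw [Polynomial.natDegree_add_eq_left_of_natDegree_lt] <;> simp; omega
    have h := ncard_eval_eq_zero_le (p := (Polynomial.X ^ q + Polynomial.X : Polynomial k))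
      (fun h => by rw [h] at hne; simp at hne; omega)
    rw [hne] at h
    convert h using 1
    rw [← Nat.card_coe_set_eq]
    congr 2
    ext y
    simp [T, AddMonoidHom.mem_ker]
  have hfix : {y : k | y ^ q = y}.ncard ≤ q := by
    have hne : (Polynomial.X ^ q - Polynomial.X : Polynomial k).natDegree = q :=
      FiniteField.X_pow_card_sub_X_natDegree_eq k (by omega)
    have h := ncard_eval_eq_zero_le (p := (Polynomial.X ^ q - Polynomial.X : Polynomial k))
      (FiniteField.X_pow_card_sub_X_ne_zero k (by omega))
    rw [hne] at h
    simpa [sub_eq_zero] using h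
  have hsub : (T.range : Set k) ⊆ {y : k | y ^ q = y} := by
    rintro _ ⟨y, rfl⟩
    change (y ^ q + y) ^ q = y ^ q + y
    rw [add_pow_of_card_eq_sq hq, pow_sq_of_card_eq_sq hq, add_comm]
  have hrange : Nat.card T.range ≤ q :=
    (Nat.card_coe_set_eq (T.range : Set k) ▸ Set.ncard_le_ncard hsub).trans hfix
  -- Kernel and image have at most `q` elements each and their sizes multiply to `q ^ 2`. So both
  -- have exactly `q`, the image is the whole fixed set of `y ↦ y ^ q`, and fibres over it are
  -- cosets of the kernel.
  have hmul : Nat.card T.ker * Nat.card T.range = q ^ 2 := by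
    rw [← hq, ← AddSubgroup.index_ker]
    exact AddSubgroup.card_mul_index _
  have hk : Nat.card T.ker = q := by
    refine le_antisymm hker ?_
    have : q * q ≤ Nat.card T.ker * q := by
      rw [← sq, ← hmul]
      exact Nat.mul_le_mul_left _ hrange
    exact Nat.le_of_mul_le_mul_right this (by omega)
  have hr : Nat.card T.range = q := by
    rw [hk, sq] at hmul
    exact Nat.eq_of_mul_eq_mul_left (by omega) hmul
  have heq : (T.range : Set k) = {y : k | y ^ q = y} :=
    Set.eq_of_subset_of_ncard_le hsub
      (hfix.trans_eq (by rw [← Nat.card_coe_set_eq]; exact hr.symm))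
  obtain ⟨y₀, hy₀⟩ : a ∈ (T.range : Set k) := heq ▸ ha
  refine Eq.trans ?_ hk
  rw [Nat.card_eq_fintype_card, ← Fintype.card_coe]
  refine Fintype.card_congr
    { toFun := fun y => ⟨y.1 - y₀, ?_⟩
      invFun := fun z => ⟨z.1 + y₀, ?_⟩
      left_inv := fun y => by simp
      right_inv := fun z => by simp }
  · rw [AddMonoidHom.mem_ker, map_sub, hy₀, sub_eq_zero]
    exact (Finset.mem_filter.mp y.2).2
  · refine Finset.mem_filter.mpr ⟨Finset.mem_univ _, ?_⟩
    change T (z.1 + y₀) = a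
    rw [map_add, hy₀, AddMonoidHom.mem_ker.mp z.2, zero_add]

theorem exists_finset_pow_eq_one [Finite k] (hq : Nat.card k = q ^ 2) :
    ∃ s : Finset k, s.card = q + 1 ∧ ∀ x ∈ s, x ^ (q + 1) = 1 := by
  have hq2 := two_le_of_card_eq_sq hq
  obtain ⟨g, hg⟩ := IsCyclic.exists_ofOrder_eq_natCard (α := kˣ)
  have hcard : Nat.card kˣ = (q - 1) * (q + 1) := by
    rw [Nat.card_units, hq]
    obtain ⟨t, rfl⟩ := Nat.exists_eq_add_of_le (show 1 ≤ q by omega)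
    rw [Nat.add_sub_cancel_left, Nat.sub_eq_iff_eq_add (by nlinarith)]
    ring
  have hprim := (IsPrimitiveRoot.coe_units_iff.mpr (IsPrimitiveRoot.orderOf g)).pow
    (orderOf_pos g) (hg.trans hcard)
  exact ⟨_, hprim.card_nthRootsFinset, fun x hx =>
    (Polynomial.mem_nthRootsFinset (by omega) _).mp hx⟩

theorem mem_E_iff {P : Fin 2 → k} : P ∈ E k q ↔ P 1 ^ q + P 1 = P 0 ^ (q + 1) := by
  change eval P (hermitianPoly k q) = 0 ↔ _
  rw [hermitianPoly, map_sub, map_sub, map_pow, map_pow, eval_X, eval_X, sub_sub, sub_eq_zero,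
    eq_comm]

open Classical in
/-- The points of the curve with abscissa `a ∈ X` and ordinate in `Y a`. -/
noncomputable def pointsOver [Finite k] (X : Finset k) (Y : k → Finset k) : Finset (E k q) :=
  Finset.univ.filter fun P => P.1 0 ∈ X ∧ P.1 1 ∈ Y (P.1 0)

theorem mem_pointsOver [Finite k] {X : Finset k} {Y : k → Finset k} {P : E k q} :
    P ∈ pointsOver X Y ↔ P.1 0 ∈ X ∧ P.1 1 ∈ Y (P.1 0) := by
  simp [pointsOver]

theorem card_pointsOver [Finite k] {X : Finset k} {Y : k → Finset k}
    (h : ∀ a ∈ X, ∀ b ∈ Y a, b ^ q + b = a ^ (q + 1)) :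
    (pointsOver X Y : Finset (E k q)).card = ∑ a ∈ X, (Y a).card := by
  rw [← Finset.card_sigma]
  refine Finset.card_bij (fun P _ => ⟨P.1 0, P.1 1⟩) ?_ ?_ ?_
  · intro P hP
    exact Finset.mem_sigma.mpr (mem_pointsOver.mp hP)
  · intro P _ Q _ hPQ
    simp only [Sigma.mk.injEq, heq_eq_eq] at hPQ
    refine Subtype.ext (funext fun i => ?_)
    fin_cases i
    · exact hPQ.1
    · exact hPQ.2
  · rintro ⟨a, b⟩ hab
    obtain ⟨ha, hb⟩ := Finset.mem_sigma.mp hab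
    exact ⟨⟨![a, b], mem_E_iff.mpr (h a ha b hb)⟩, mem_pointsOver.mpr ⟨ha, hb⟩, rfl⟩

theorem prod_X_sub_C_mem_idealOf {D : Finset (E k q)} {i : Fin 2} {s : Finset k}
    (h : ∀ P ∈ D, P.1 i ∈ s) :
    (∏ a ∈ s, (X i - C a) : MvPolynomial (Fin 2) k) ∈ idealOf D := by
  rw [mem_idealOf]
  intro P hP
  rw [map_prod]
  exact Finset.prod_eq_zero (h P hP) (by simp)

theorem span_pair_le_idealOf {D : Finset (E k q)} {F G : MvPolynomial (Fin 2) k}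
    (hF : F ∈ idealOf D) (hG : G ∈ idealOf D) : Ideal.span {F, G} ≤ idealOf D := by
  rw [Ideal.span_le]
  rintro _ (rfl | rfl)
  · exact hF
  · exact hG

/-- A finite grid contained in the curve is a complete intersection. -/
theorem exists_grid [Finite k] (hq0 : 0 < q) {s t : Finset k} (hs : ∀ x ∈ s, x ^ (q + 1) = 1)
    (ht : ∀ y ∈ t, y ^ q + y = 1) :
    ∃ D : Finset (E k q), ∃ F G : MvPolynomial (Fin 2) k, HasWLead q F (expXY s.card 0) ∧
      HasWLead q G (expXY 0 t.card) ∧ idealOf D = Ideal.span {F, G} := by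
  have hF := hasWLead_prod_X_sub_C hq0 0 s
  have hG := hasWLead_prod_X_sub_C hq0 1 t
  rw [show Finsupp.single 0 s.card = expXY s.card 0 by simp [expXY]] at hF
  rw [show Finsupp.single 1 t.card = expXY 0 t.card by simp [expXY]] at hG
  refine ⟨pointsOver s fun _ => t, _, _, hF, hG, idealOf_eq_span hF hG
    (span_pair_le_idealOf (prod_X_sub_C_mem_idealOf fun P hP => (mem_pointsOver.mp hP).1)
      (prod_X_sub_C_mem_idealOf fun P hP => (mem_pointsOver.mp hP).2)) ?_⟩
  rw [card_pointsOver fun a ha b hb => by rw [hs a ha, ht b hb]]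
  simp

theorem exists_grid_of_card_eq_sq [Finite k] (hq : Nat.card k = q ^ 2) {a b : ℕ} (ha : a ≤ q + 1)
    (hb : b ≤ q) :
    ∃ D : Finset (E k q), ∃ F G : MvPolynomial (Fin 2) k, HasWLead q F (expXY a 0) ∧
      HasWLead q G (expXY 0 b) ∧ idealOf D = Ideal.span {F, G} := by
  classical
  have := Fintype.ofFinite k
  obtain ⟨s, hs, hs1⟩ := exists_finset_pow_eq_one hq
  obtain ⟨s', hs', rfl⟩ := Finset.exists_subset_card_eq (ha.trans_eq hs.symm)
  obtain ⟨t', ht', rfl⟩ :=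
    Finset.exists_subset_card_eq (hb.trans_eq (card_trace_fiber hq (one_pow q)).symm)
  refine exists_grid (by have := two_le_of_card_eq_sq hq; omega) (fun x hx => hs1 x (hs' hx))
    fun y hy => (Finset.mem_filter.mp (ht' hy)).2

/-- The equation of degree `q` in `y` obtained from the equation of the curve by removing
`x ^ (q + 1)` with the help of `f`. -/
theorem exists_reduced_hermitianPoly (hq : 2 ≤ q) {f : MvPolynomial (Fin 2) k} {μ : ℕ}
    (hμ : μ ≤ q) (hf : HasWLead q f (expXY μ 0)) :
    ∃ G, HasWLead q G (expXY 0 q) ∧ Ideal.span {f, G} = Ideal.span {hermitianPoly k q, f} := by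
  set α := (coeff (expXY μ 0) f)⁻¹ with hα
  -- The multiplier `h` raises the leading term of `f` exactly to `x ^ (q + 1)`, so that `y ^ q`
  -- remains as the unique term of top weight.
  set h : MvPolynomial (Fin 2) k := monomial (expXY (q + 1 - μ) 0) α with hh
  refine ⟨-hermitianPoly k q + h * f, ?_, ?_⟩
  · have heq : -hermitianPoly k q + h * f = monomial (expXY 0 q) 1 +
        (X 1 + h * (f - monomial (expXY μ 0) (coeff (expXY μ 0) f))) := by
      have h1 : h * monomial (expXY μ 0) (coeff (expXY μ 0) f) = X 0 ^ (q + 1) := by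
        rw [hh, monomial_mul, hα, inv_mul_cancel₀ hf.1, X_pow_eq_monomial]
        congr 2
        exact exp_ext (by simp; omega) (by simp)
      have h2 : monomial (expXY 0 q) (1 : k) = X 1 ^ q := by
        rw [X_pow_eq_monomial]
        congr 2
        exact exp_ext (by simp) (by simp)
      rw [mul_sub, h1, h2, hermitianPoly]
      ring
    rw [heq]
    refine (hasWLead_monomial _).add_of_lt fun d hd => ?_
    classical
    rcases Finset.mem_union.mp (support_add hd) with h' | h'
    · rw [support_X, Finset.mem_singleton] at h'
      subst h'
      simp only [wdeg, expXY_apply_zero, expXY_apply_one]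
      simp
      nlinarith
    · obtain ⟨v, hv, e, he, rfl⟩ := exists_of_mem_support_mul h'
      have h3 := hf.sub_monomial he
      have h4 := Finset.mem_singleton.mp (support_monomial_subset hv)
      subst h4
      rw [wdeg_add]
      rw [wdeg_expXY] at h3 ⊢
      rw [wdeg_expXY]
      obtain ⟨t, ht⟩ := Nat.exists_eq_add_of_le (show μ ≤ q + 1 by omega)
      rw [ht, Nat.add_sub_cancel_left]
      nlinarith
  · refine le_antisymm ?_ ?_ <;> rw [Ideal.span_le] <;> rintro _ (rfl | rfl)
    · exact Ideal.subset_span (by simp)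
    · exact add_mem (neg_mem (Ideal.subset_span (by simp)))
        (Ideal.mul_mem_left _ _ (Ideal.subset_span (by simp)))
    · refine Ideal.mem_span_pair.mpr ⟨h, -1, ?_⟩
      ring
    · exact Ideal.subset_span (by simp)

end Points

/-! ### Leading monomials for the degree reverse lexicographic order -/

section LeadingMonomials

variable {k : Type*} [Field k] {q : ℕ}

/-- A monomial of total degree at most `a - 1` has weight at most `(a - 1) * (q + 1)`, which is
below `a * q` exactly when `a ≤ q`. -/
theorem hasLM_x_pow_iff {f : MvPolynomial (Fin 2) k} {a : ℕ} (ha : a ≤ q) :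
    HasLM f (expXY a 0) ↔ HasWLead q f (expXY a 0) := by
  rw [HasLM, HasWLead, mem_support_iff]
  refine and_congr_right fun _ => forall₃_congr fun d _ hne => ?_
  simp only [DegRevLexLT, wdeg, expXY_apply_zero, expXY_apply_one]
  constructor
  · intro h
    obtain ⟨t, rfl⟩ : ∃ t, a = d 0 + d 1 + 1 + t := ⟨a - (d 0 + d 1 + 1), by omega⟩
    nlinarith
  · intro h
    left
    by_contra hle
    have : a * q ≤ (d 0 + d 1) * q := Nat.mul_le_mul_right q (by omega)
    nlinarith

theorem hasLM_y_pow_iff {f : MvPolynomial (Fin 2) k} {b : ℕ} (hb : b < q) :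
    HasLM f (expXY 0 b) ↔ HasWLead q f (expXY 0 b) := by
  rw [HasLM, HasWLead, mem_support_iff]
  refine and_congr_right fun _ => forall₃_congr fun d _ hne => ?_
  have hne' : ¬ (d 0 = 0 ∧ d 1 = b) := fun h => hne (exp_ext (by simpa using h.1)
    (by simpa using h.2))
  simp only [DegRevLexLT, wdeg, expXY_apply_zero, expXY_apply_one]
  constructor
  · intro h
    have h1 : d 1 < b := by omega
    have h2 : (d 0 + d 1) * q ≤ b * q := Nat.mul_le_mul_right q (by omega)
    nlinarith
  · intro h
    have : d 0 + d 1 < b + 1 := by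
      by_contra hle
      have : (b + 1) * q ≤ (d 0 + d 1) * q := Nat.mul_le_mul_right q (by omega)
      nlinarith
    omega

/-- Replacing `H` by its reduction modulo `F` puts type (i) in the same shape as type (ii): two
generators leading with pure powers. -/
theorem typeI_iff (hq : 2 ≤ q) {μ : ℕ} (hμ : μ ≤ q) {D : Finset (E k q)} :
    TypeI μ D ↔ ∃ F G : MvPolynomial (Fin 2) k, HasWLead q F (expXY μ 0) ∧
      HasWLead q G (expXY 0 q) ∧ idealOf D = Ideal.span {F, G} ∧
      Ideal.span {F, G} = Ideal.span {hermitianPoly k q, F} := by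
  constructor
  · rintro ⟨f, hf, hD⟩
    rw [hasLM_x_pow_iff hμ] at hf
    obtain ⟨G, hG, hspan⟩ := exists_reduced_hermitianPoly hq hμ hf
    exact ⟨f, G, hf, hG, Eq.trans hD hspan.symm, hspan⟩
  · rintro ⟨F, G, hF, hG, hD, hspan⟩
    exact ⟨F, (hasLM_x_pow_iff hμ).mpr hF, hD.trans hspan⟩

theorem typeII_iff {μ : ℕ} (hμ : μ < q) {D : Finset (E k q)} :
    TypeII μ D ↔ ∃ F G : MvPolynomial (Fin 2) k, HasWLead q F (expXY q 0) ∧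
      HasWLead q G (expXY 0 μ) ∧ idealOf D = Ideal.span {F, G} := by
  simp only [TypeII, hasLM_x_pow_iff le_rfl, hasLM_y_pow_iff hμ, IsCompleteIntersection]

/-- A nonzero polynomial supported in the `(q + 1) × q` box cannot vanish on a grid of that size,
whereas `H` vanishes on such a grid in `E`. -/
theorem curve_ne_hermitian [Finite k] (hq : Nat.card k = q ^ 2) {f : MvPolynomial (Fin 2) k}
    {u : Fin 2 →₀ ℕ} (hf : HasLM f u) (hbox : ∀ d ∈ f.support, d 0 < q + 1 ∧ d 1 < q) :
    curve f ≠ curve (hermitianPoly k q) := by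
  intro h
  obtain ⟨D, F, G, hF, hG, hD⟩ := exists_grid_of_card_eq_sq hq le_rfl le_rfl
  have hfD : f ∈ idealOf D := by
    rw [mem_idealOf]
    intro P _
    have key : ∀ g : MvPolynomial (Fin 2) k,
        (algebraMap k (AlgebraicClosure k) ∘ P.1) ∈ curve g ↔ eval P.1 g = 0 := by
      intro g
      rw [curve, zeroLocus_span]
      change (∀ p ∈ ({g} : Set _), _) ↔ _
      simp only [Set.mem_singleton_iff, forall_eq]
      rw [aeval_algebraMap_apply, FaithfulSMul.algebraMap_eq_zero_iff]
      simp
    rw [← key, h, key]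
    exact P.2
  rw [hD] at hfD
  have h0 := eq_zero_of_mem_span_of_mem_box hF hG hfD (fun d hd => hbox d hd)
  simp [h0, HasLM] at hf

end LeadingMonomials

/-! ### Numerical estimates -/

section Arithmetic

/-- For `s + 1 ≥ q` the bound is `(r + 1) * q + t * (q + 1)` with `t = s + 1 - q`, a shift of the
order itself. Otherwise it is a product of two factors with sum at least `q + i + 1`, smallest when
they are as unequal as allowed, namely `q` and `i + 1`. -/
theorem le_orderBound {q i r s : ℕ} (hi : i + 2 ≤ q) (hr : r ≤ q)
    (h : q ^ 2 + i * q + i ≤ r * q + s * (q + 1) + q) :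
    (i + 1) * q ≤ (r + 1) * (s + 1) + (q - r) * (s + 1 - q) ∧
      ((i + 1) * q = (r + 1) * (s + 1) + (q - r) * (s + 1 - q) →
        r = i ∧ s + 1 = q ∨ r + 1 = q ∧ s = i) := by
  rcases le_or_gt q (s + 1) with hs | hs
  · obtain ⟨t, ht⟩ := Nat.exists_eq_add_of_le hs
    obtain ⟨p, hp⟩ := Nat.exists_eq_add_of_le hr
    have hν : (r + 1) * (s + 1) + (q - r) * (s + 1 - q) = (r + 1) * q + t * (q + 1) := by
      rw [ht, Nat.add_sub_cancel_left, show q - r = p by omega]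
      nth_rw 3 [hp]
      ring
    have hs' : s * (q + 1) + (q + 1) = (q + t) * (q + 1) := by rw [← ht]; ring
    have h' : i * q + i + 1 ≤ (r + 1) * q + t * (q + 1) := by nlinarith
    have hge : i + 1 ≤ r + 1 + t := by
      by_contra hlt
      have : (r + 1 + t) * q ≤ i * q := Nat.mul_le_mul_right q (by omega)
      nlinarith
    have hge' : (i + 1) * q ≤ (r + 1 + t) * q := Nat.mul_le_mul_right q hge
    rw [hν]
    refine ⟨by nlinarith, fun heq => Or.inl ?_⟩
    have ht0 : t = 0 := by nlinarith
    subst ht0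
    have : i + 1 = r + 1 := Nat.eq_of_mul_eq_mul_right (show 0 < q by omega) (by linarith)
    exact ⟨by omega, by omega⟩
  · rw [show s + 1 - q = 0 by omega, mul_zero, add_zero]
    have hge : q + i ≤ r + (s + 1) := by
      by_contra hlt
      have : (r + (s + 1)) * q ≤ (q + i - 1) * q := Nat.mul_le_mul_right q (by omega)
      obtain ⟨w, hw⟩ := Nat.exists_eq_add_of_le (show 1 ≤ q + i by omega)
      rw [hw, Nat.add_sub_cancel_left] at this
      have h2 : (q + i) * q = (1 + w) * q := by rw [hw]
      nlinarith
    obtain ⟨l, hl⟩ := Nat.exists_eq_add_of_le hge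
    obtain ⟨p, hp⟩ := Nat.exists_eq_add_of_le hs
    rcases Nat.lt_or_ge (i + l) (s + 1) with hlt | hle
    · obtain ⟨e, he⟩ := Nat.exists_eq_add_of_le hlt
      have he' : s + 1 = i + l + 1 + e := by omega
      have hp' : q = s + 1 + 1 + p := by omega
      have hr1 : r + 1 = i + l + p + 2 := by omega
      have hν : (r + 1) * (s + 1) = (i + l + 1) * q + (p + 1) * e := by
        rw [hr1, he', hp', he']
        ring
      have h1 : (i + l + 1) * q = (i + 1) * q + l * q := by ring
      rw [hν, h1]
      refine ⟨by omega, fun heq => Or.inr ?_⟩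
      have hl0 : l * q = 0 := by omega
      have he0 : (p + 1) * e = 0 := by omega
      have hl0' : l = 0 := by
        rcases Nat.mul_eq_zero.mp hl0 with h | h <;> omega
      have he0' : e = 0 := by
        rcases Nat.mul_eq_zero.mp he0 with h | h <;> omega
      subst hl0' he0'
      exact ⟨by omega, by omega⟩
    -- The extreme `r + 1 = q + 1` is not settled by the sum of the factors alone; the weight
    -- hypothesis excludes `s < i`.
    · have hrq : r = q := by omega
      subst hrq
      have h1 : (r + 1) * (i + 1) ≤ (r + 1) * (s + 1) ∨ s + 1 ≤ i := by
        rcases Nat.lt_or_ge i (s + 1) with h | h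
        · exact Or.inl (Nat.mul_le_mul_left _ h)
        · exact Or.inr h
      rcases h1 with h1 | h1
      · exact ⟨by nlinarith, fun heq => by nlinarith⟩
      · exfalso
        have : (s + 1) * (r + 1) ≤ i * (r + 1) := Nat.mul_le_mul_right _ h1
        nlinarith

theorem mem_Lam_iff {q : ℕ} {z : ℤ} :
    z ∈ Lam q ↔ ∃ a b : ℕ, (a : ℤ) * q + b * ((q : ℤ) + 1) = z := by
  rw [Lam, AddSubmonoid.mem_closure_pair]
  simp

theorem delta_eq {q m n : ℕ} (h : m + q + 2 = q ^ 2 + n) : delta q m = n := by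
  have : ((m + q + 2 : ℕ) : ℤ) = ((q ^ 2 + n : ℕ) : ℤ) := by rw [h]
  push_cast at this
  unfold delta
  linarith

theorem mem_LamB_of_le {q r s : ℕ} (hr : r ≤ q) (hs : s < q ^ 2 - q) :
    r * q + s * (q + 1) ∈ LamB q :=
  ⟨expXY r s, Or.inl ⟨by simpa using hr, by simpa using hs⟩, wdeg_expXY q r s⟩

/-- For `j < q`, the number `i * q + j` lies in `Λ` exactly when `j ≤ i`. If `m` is not admissible,
then `i < j` and the next element of `Λ` is `(i + 1) * q`. -/
theorem exists_of_lt_mTilde {q m : ℕ} (hq : 2 ≤ q) (hm₁ : (q : ℤ) ^ 2 - q - 1 ≤ m)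
    (hm₂ : (m : ℤ) ≤ 2 * (q : ℤ) ^ 2 - 2 * q - 3) (hm : m < mTilde q m) :
    ∃ i j, i < j ∧ j < q ∧ i + 2 ≤ q ∧ m + q + 2 = q ^ 2 + (i * q + j) ∧
      deltaTilde q m = (i + 1 : ℕ) * q := by
  obtain ⟨n, hn⟩ := Nat.exists_eq_add_of_le (show q ^ 2 ≤ m + q + 2 by zify; linarith)
  have hn1 : 1 ≤ n := by zify at hn ⊢; linarith
  have hn2 : n + q + 1 ≤ q ^ 2 := by zify at hn ⊢; linarith
  have hnij : n = n / q * q + n % q := by rw [mul_comm]; exact (Nat.div_add_mod n q).symm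
  have hj : n % q < q := Nat.mod_lt _ (by omega)
  generalize n / q = i at *
  generalize n % q = j at *
  have hi : i + 2 ≤ q := by
    by_contra hlt
    have : q * q ≤ (i + 1) * q := Nat.mul_le_mul_right q (by omega)
    nlinarith
  have hbd : ∀ t, t + 3 ≤ 2 * q → t < q ^ 2 - q := by
    intro t ht
    have : q + t + 1 ≤ q ^ 2 := by nlinarith
    omega
  have hij : i < j := by
    by_contra hle
    -- If `j ≤ i` then `m` is itself admissible: `m + 1` is the weight of `x ^ q * y ^ (i - 1)` when
    -- `j = i`, and of `x ^ (i - j - 1) * y ^ (q - 1 + j)` when `j < i`.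
    refine absurd hm (not_lt.mpr (Nat.sInf_le ⟨le_rfl, ?_, ?_⟩))
    · obtain ⟨p, hp⟩ := Nat.exists_eq_add_of_le (show 1 ≤ q by omega)
      obtain ⟨l, hl⟩ := Nat.exists_eq_add_of_le (show j ≤ i by omega)
      rcases Nat.eq_zero_or_pos l with rfl | hl0
      · have hi0 : 1 ≤ i := by
          by_contra h0
          have : i = 0 := by omega
          subst this
          omega
        obtain ⟨i', rfl⟩ := Nat.exists_eq_add_of_le hi0
        convert mem_LamB_of_le (q := q) (r := q) (s := i') le_rfl (hbd _ (by omega)) using 1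
        subst hnij
        nlinarith
      · obtain ⟨l', rfl⟩ := Nat.exists_eq_add_of_le hl0
        convert mem_LamB_of_le (q := q) (r := l') (s := p + j) (by omega)
          (hbd _ (by omega)) using 1
        subst hnij hl hp
        nlinarith
    · rw [delta_eq hn, mem_Lam_iff]
      obtain ⟨l, hl⟩ := Nat.exists_eq_add_of_le (show j ≤ i by omega)
      refine ⟨l, j, ?_⟩
      rw [hnij, hl]
      push_cast
      ring
  refine ⟨i, j, hij, hj, hi, by omega, ?_⟩
  obtain ⟨hle, -, hΛ⟩ := mTilde_mem q m hq hm₂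
  -- The candidate has `δ(m') = (i + 1) * q`, and `m' + 1` is the weight of `x ^ i * y ^ (q - 1)`.
  obtain ⟨m', hm'⟩ := Nat.exists_eq_add_of_le
    (show q + 2 ≤ q ^ 2 + (i + 1) * q by nlinarith)
  have hm'd : delta q m' = ((i + 1) * q : ℕ) := delta_eq (by omega)
  have hm'e : mTilde q m ≤ m' := by
    refine Nat.sInf_le ⟨?_, ?_, ?_⟩
    · have : (i + 1) * q = i * q + q := by ring
      omega
    · obtain ⟨p, hp⟩ := Nat.exists_eq_add_of_le (show 1 ≤ q by omega)
      convert mem_LamB_of_le (q := q) (r := i) (s := p) (by omega) (hbd _ (by omega)) using 1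
      subst hp
      nlinarith
    · rw [hm'd, mem_Lam_iff]
      exact ⟨i + 1, 0, by push_cast; ring⟩
  have hup : deltaTilde q m ≤ ((i + 1) * q : ℕ) := by
    rw [← hm'd, deltaTilde, delta, delta]
    have : (mTilde q m : ℤ) ≤ m' := by exact_mod_cast hm'e
    linarith
  have hlow : ((i * q + j : ℕ) : ℤ) ≤ deltaTilde q m := by
    rw [← hnij, ← delta_eq hn, deltaTilde, delta, delta]
    have : (m : ℤ) ≤ mTilde q m := by exact_mod_cast hle
    linarith
  rw [show ((i + 1 : ℕ) : ℤ) * q = ((i + 1) * q : ℕ) by push_cast; ring]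
  refine le_antisymm hup ?_
  obtain ⟨a, b, hab⟩ := mem_Lam_iff.mp hΛ
  change _ = deltaTilde q m at hab
  rw [← hab] at hlow ⊢
  have hlow' : i * q + j ≤ a * q + b * (q + 1) := by exact_mod_cast hlow
  have : i + 1 ≤ a + b := by
    by_contra hlt
    have : (a + b) * q ≤ i * q := Nat.mul_le_mul_right q (by omega)
    nlinarith
  have : (i + 1) * q ≤ (a + b) * q := Nat.mul_le_mul_right q this
  have : (i + 1) * q ≤ a * q + b * (q + 1) := by nlinarith
  exact_mod_cast this

end Arithmetic

/-! ### Minimum-weight codewords -/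

section MinimumWeight

variable {k : Type*} [Field k] [Finite k] {q : ℕ}

theorem hammingNorm_eq_card [DecidableEq k] {c : E k q → k} {D : Finset (E k q)}
    (hc : Function.support c = D) : hammingNorm c = D.card := by
  rw [hammingNorm]
  congr 1
  ext P
  rw [← Finset.mem_coe (s := D), ← hc]
  simp

theorem hammingNorm_le_card [DecidableEq k] {c : E k q → k} {D : Finset (E k q)}
    (hc : Function.support c ⊆ D) : hammingNorm c ≤ D.card := by
  refine Finset.card_le_card fun P hP => ?_
  exact hc (Finset.mem_filter.mp hP).2

/-- All points of `E` on `μ` vertical lines: each line carries `q` of them, because `a ^ (q + 1)` is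
fixed by the `q`-th power map. -/
theorem exists_card_eq_mul (hq : Nat.card k = q ^ 2) {μ : ℕ} (hμ : μ ≤ q) :
    ∃ D : Finset (E k q), ∃ F G : MvPolynomial (Fin 2) k, HasWLead q F (expXY μ 0) ∧
      HasWLead q G (expXY 0 q) ∧ Ideal.span {F, G} ≤ idealOf D ∧ D.card = μ * q := by
  classical
  have := Fintype.ofFinite k
  have hq2 := two_le_of_card_eq_sq hq
  obtain ⟨s, -, rfl⟩ := Finset.exists_subset_card_eq (s := (Finset.univ : Finset k)) (n := μ) (by
    rw [Finset.card_univ, Fintype.card_eq_nat_card, hq]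
    nlinarith)
  have hF := hasWLead_prod_X_sub_C (show 0 < q by omega) 0 s
  rw [show Finsupp.single 0 s.card = expXY s.card 0 by simp [expXY]] at hF
  obtain ⟨G, hG, hspan⟩ := exists_reduced_hermitianPoly hq2 hμ hF
  refine ⟨pointsOver s fun a => Finset.univ.filter fun y => y ^ q + y = a ^ (q + 1), _, G, hF,
    hG, ?_, ?_⟩
  · rw [hspan]
    exact span_pair_le_idealOf (hermitianPoly_mem_idealOf _)
      (prod_X_sub_C_mem_idealOf fun P hP => (mem_pointsOver.mp hP).1)
  · rw [card_pointsOver fun a _ b hb => (Finset.mem_filter.mp hb).2,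
      Finset.sum_congr rfl fun a _ => card_trace_fiber hq ?_, Finset.sum_const, smul_eq_mul]
    rw [pow_succ, mul_pow, pow_sq_of_card_eq_sq hq, mul_comm]

variable {i m : ℕ}

/-- Words of `C_m` have weight at least `(i + 1) * q`, with two possible orders in the case of
equality. -/
theorem le_card_of_mem_code (hi : i + 2 ≤ q) (hm : q ^ 2 + i * q + i + 1 ≤ m + q + 2)
    {c : E k q → k} (hc : c ∈ code k q m) (h0 : c ≠ 0) {D : Finset (E k q)}
    (hD : Function.support c ⊆ D) :
    (i + 1) * q ≤ D.card ∧ (D.card = (i + 1) * q → ∃ r s, IsOrder c (r * q + s * (q + 1)) ∧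
      m < r * q + s * (q + 1) ∧ (r = i ∧ s + 1 = q ∨ r + 1 = q ∧ s = i)) := by
  obtain ⟨r, s, hr, hlt, hord⟩ := exists_isOrder (by omega) hc h0
  have hcard := hord.card_le hr hD
  obtain ⟨hle, heq⟩ := le_orderBound (i := i) (s := s) hi hr (by omega)
  refine ⟨hle.trans hcard, fun hDc => ⟨r, s, hord, hlt, heq ?_⟩⟩
  exact le_antisymm hle (hcard.trans_eq hDc)

theorem exists_mem_code_card_le (hq : Nat.card k = q ^ 2) (hi : i + 2 ≤ q)
    (hm : m + q + 2 ≤ q ^ 2 + (i + 1) * q) :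
    ∃ c ∈ code k q m, c ≠ 0 ∧ ∃ D : Finset (E k q), Function.support c ⊆ D ∧
      D.card = (i + 1) * q := by
  obtain ⟨D, F, G, hF, hG, hle, hD⟩ := exists_card_eq_mul hq (show i + 1 ≤ q by omega)
  obtain ⟨p, rfl⟩ := Nat.exists_eq_add_of_le' (show 1 ≤ q by omega)
  obtain ⟨c, hc, h0, hs⟩ := exists_codeword (m := m) hF hG hle hD (by nlinarith)
  exact ⟨c, hc, h0, D, hs, hD⟩

theorem isMinWeightCodeword_iff (hq : Nat.card k = q ^ 2) (hi : i + 2 ≤ q)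
    (hm : q ^ 2 + i * q + i + 1 ≤ m + q + 2) (hm' : m + q + 2 ≤ q ^ 2 + (i + 1) * q)
    {c : E k q → k} {D : Finset (E k q)} (hD : Function.support c = D) :
    IsMinWeightCodeword (code k q m) c ↔ c ∈ code k q m ∧ c ≠ 0 ∧ D.card = (i + 1) * q := by
  classical
  rw [IsMinWeightCodeword]
  refine and_congr_right fun hc => and_congr_right fun h0 => ?_
  rw [hammingNorm_eq_card hD]
  constructor
  · intro h
    obtain ⟨c', hc', h0', D', hs', hD'⟩ := exists_mem_code_card_le (k := k) hq hi hm'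
    refine le_antisymm ?_ (le_card_of_mem_code hi hm hc h0 hD.le).1
    exact (h c' hc' h0').trans ((hammingNorm_le_card hs').trans_eq hD')
  · intro h c' hc' h0'
    have hsupp : Function.support c' = (Finset.univ.filter fun P => c' P ≠ 0 :
        Finset (E k q)) := by
      ext P
      simp
    rw [h, hammingNorm_eq_card hsupp]
    exact (le_card_of_mem_code hi hm hc' h0' hsupp.le).1

theorem mem_minSupports_of_idealOf_eq_span (hq : Nat.card k = q ^ 2) (hi : i + 2 ≤ q)
    (hm : q ^ 2 + i * q + i + 1 ≤ m + q + 2) (hm' : m + q + 2 ≤ q ^ 2 + (i + 1) * q)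
    {D : Finset (E k q)} {F G : MvPolynomial (Fin 2) k} {a b : ℕ}
    (hF : HasWLead q F (expXY (a + 1) 0)) (hG : HasWLead q G (expXY 0 (b + 1)))
    (hD : idealOf D = Ideal.span {F, G}) (hab : (a + 1) * (b + 1) = (i + 1) * q)
    (hlt : m < a * q + b * (q + 1)) : D ∈ minSupports k q m := by
  have hcard := card_eq_of_idealOf_eq_span hF hG hD
  obtain ⟨c, hc, h0, hs⟩ := exists_codeword hF hG hD.ge hcard hlt
  -- A support strictly inside `D` would violate the lower bound on weights.
  have hsupp : Function.support c = D := by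
    refine Set.eq_of_subset_of_ncard_le hs ?_
    rw [Set.ncard_coe_finset, hcard, hab, ← Set.Finite.coe_toFinset (Set.toFinite c.support),
      Set.ncard_coe_finset]
    exact (le_card_of_mem_code hi hm hc h0 (by simp)).1
  exact ⟨c, (isMinWeightCodeword_iff hq hi hm hm' hsupp).mpr ⟨hc, h0, hcard.trans hab⟩, hsupp⟩

theorem mem_minSupports_iff (hq : Nat.card k = q ^ 2) (hi : i + 2 ≤ q)
    (hm : q ^ 2 + i * q + i + 1 ≤ m + q + 2) (hm' : m + q + 2 < q ^ 2 + (i + 1) * q)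
    (D : Finset (E k q)) :
    D ∈ minSupports k q m ↔
      TypeI (i + 1) D ∨ m + q + 2 = q ^ 2 + i * q + i + 1 ∧ TypeII (i + 1) D := by
  have hq2 : 2 ≤ q := by omega
  rw [typeI_iff hq2 (by omega), typeII_iff (by omega)]
  obtain ⟨p, hp⟩ := Nat.exists_eq_add_of_le' (show 1 ≤ q by omega)
  constructor
  · rintro ⟨c, hc, hD⟩
    obtain ⟨hcode, h0, hcard⟩ := (isMinWeightCodeword_iff hq hi hm hm'.le hD).mp hc
    obtain ⟨r, s, hord, hlt, ⟨rfl, hs⟩ | ⟨hr, rfl⟩⟩ :=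
      (le_card_of_mem_code hi hm hcode h0 hD.le).2 hcard
    · left
      obtain ⟨F, hFD, hF⟩ := hord.exists_hasWLead_mem_idealOf (u := expXY (r + 1) 0) (by omega)
        hD.le (by rw [hs, hcard]) (by simp; omega) (by simp [mem_boxFinset])
      -- The second generator is taken from `H`, not from the order of `c`, so that the ideal is
      -- visibly `⟨H, F⟩`.
      obtain ⟨G, hG, hspan⟩ := exists_reduced_hermitianPoly hq2 (by omega) hF
      refine ⟨F, G, hF, hG, idealOf_eq_span hF hG ?_ hcard, hspan⟩
      rw [hspan]
      exact span_pair_le_idealOf (hermitianPoly_mem_idealOf D) hFD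
    · right
      have hcard' : D.card = (r + 1) * (s + 1) := by rw [hr, hcard, mul_comm]
      refine ⟨?_, ?_⟩
      · obtain rfl : r = p := by omega
        -- The order is here `(q - 1) * q + i * (q + 1)`; that it exceeds `m` leaves only the
        -- smallest `m` allowed by `hm`.
        refine le_antisymm ?_ hm
        rw [hp] at hlt ⊢
        nlinarith
      obtain ⟨F, hFD, hF⟩ := hord.exists_hasWLead_mem_idealOf (u := expXY (r + 1) 0) (by omega)
        hD.le hcard' (by simp; omega) (by simp [mem_boxFinset])
      obtain ⟨G, hGD, hG⟩ := hord.exists_hasWLead_mem_idealOf (u := expXY 0 (s + 1)) (by omega)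
        hD.le hcard' (by simp) (by simp [mem_boxFinset])
      rw [hr] at hF
      exact ⟨F, G, hF, hG, idealOf_eq_span hF hG (span_pair_le_idealOf hFD hGD)
        (by rw [hcard, mul_comm])⟩
  · subst hp
    rintro (⟨F, G, hF, hG, hD, -⟩ | ⟨hspec, F, G, hF, hG, hD⟩)
    · exact mem_minSupports_of_idealOf_eq_span hq hi hm hm'.le hF hG hD rfl (by nlinarith)
    · exact mem_minSupports_of_idealOf_eq_span hq hi hm hm'.le hF hG hD (mul_comm _ _)
        (by nlinarith)

end MinimumWeight

end HermitianCode

theorem mainTheorem5 {k : Type*} [Field k] [Finite k] (q : ℕ) (hq : Nat.card k = q ^ 2) (m : ℕ)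
    (hm₁ : (q : ℤ) ^ 2 - q - 1 ≤ m) (hm₂ : (m : ℤ) ≤ 2 * (q : ℤ) ^ 2 - 2 * q - 3)
    (hm : m < HermitianCode.mTilde q m) :
    ∃ μ : ℕ, 1 ≤ μ ∧ μ ≤ q - 1 ∧
      HermitianCode.deltaTilde q m = HermitianCode.wdeg q (HermitianCode.expXY μ 0) ∧
      HermitianCode.deltaTilde q m = μ * q ∧
      (∀ D : Finset (HermitianCode.E k q),
        D ∈ HermitianCode.minSupports k q m ↔
          (HermitianCode.TypeI μ D ∨
            ((m : ℤ) = ((μ : ℤ) + q - 3) * (q + 1) + 1 ∧ HermitianCode.TypeII μ D))) ∧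
      ((m : ℤ) = ((μ : ℤ) + q - 3) * (q + 1) + 1 →
        ∃ D : Finset (HermitianCode.E k q), HermitianCode.TypeII μ D) ∧
      (∀ f : MvPolynomial (Fin 2) k,
        HermitianCode.HasLM f (HermitianCode.expXY q 0) ∨
          HermitianCode.HasLM f (HermitianCode.expXY 0 μ) →
        HermitianCode.curve f ≠ HermitianCode.curve (HermitianCode.hermitianPoly k q)) := by
  have hq2 := HermitianCode.two_le_of_card_eq_sq hq
  obtain ⟨i, j, hij, hj, hi, hmn, hδ⟩ := HermitianCode.exists_of_lt_mTilde hq2 hm₁ hm₂ hm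
  -- The special value of `m` is the case `j = i + 1`.
  have hspec : (m : ℤ) = (((i + 1 : ℕ) : ℤ) + q - 3) * (q + 1) + 1 ↔
      m + q + 2 = q ^ 2 + i * q + i + 1 := by
    zify
    constructor <;> intro h <;> linarith
  refine ⟨i + 1, by omega, by omega, ?_, hδ, fun D => ?_, fun _ => ?_, ?_⟩
  · rw [hδ, HermitianCode.wdeg_expXY]
    push_cast
    ring
  · rw [hspec]
    exact HermitianCode.mem_minSupports_iff hq hi (by omega) (by rw [add_mul, one_mul]; omega) D
  · obtain ⟨D, h⟩ := HermitianCode.exists_grid_of_card_eq_sq (k := k) hq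
      (a := q) (b := i + 1) (by omega) (by omega)
    exact ⟨D, (HermitianCode.typeII_iff (by omega)).mpr h⟩
  -- Either leading monomial bounds the total degree by `q`, with `y ^ q` excluded, so the support
  -- lies in the `(q + 1) × q` box.
  · rintro f (hf | hf)
    · refine HermitianCode.curve_ne_hermitian hq hf fun d hd => ?_
      by_cases hd' : d = HermitianCode.expXY q 0
      · subst hd'
        simp
        omega
      · have := hf.2 d hd hd'
        simp only [HermitianCode.DegRevLexLT, HermitianCode.expXY_apply_zero,
          HermitianCode.expXY_apply_one] at this
        omega
    · refine HermitianCode.curve_ne_hermitian hq hf fun d hd => ?_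
      by_cases hd' : d = HermitianCode.expXY 0 (i + 1)
      · subst hd'
        simp
        omega
      · have := hf.2 d hd hd'
        simp only [HermitianCode.DegRevLexLT, HermitianCode.expXY_apply_zero,
          HermitianCode.expXY_apply_one] at this
        omega
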